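/- Let $\Sigma$ be a finite alphabet. An edit operation is a pair $(a,b)\in(\Sigma\cup\{\varepsilon\})^2\setminus\{(\varepsilon,\varepsilon)\}$; it has weight $0$ if $a=b$ and weight $1$ otherwise. An edit path from $x\in\Sigma^*$ to $y\in\Sigma^*$ is a finite sequence $p=(a_1,b_1)\cdots(a_n,b_n)$ of edit operations with $a_1\cdots a_n=x$ and $b_1\cdots b_n=y$; its cost is the sum of the weights of its operations divided by its length $n$ (and $0$ if $n=0$). The normalized edit distance $\mathrm{ned}(x,y)$ is the minimal cost of an edit path from $x$ to $y$. For $X,Y\subseteq\Sigma^*$ the asymptotic directional distance is $$\overrightarrow{\mathrm{AH}}_{\mathrm{ned}}(X,Y)=\lim_{k\to\infty}\ \sup_{x\in X,\ |x|\ge k}\ \inf_{y\in Y}\ \mathrm{ned}(x,y),$$ where suprema and infima are taken in $[0,\sup \mathrm{ned}]$ (so a supremum over the empty set is $0$, and an infimum over the empty set is $\sup\mathrm{ned}$). **Theorem.** The following decision problem is PSPACE-hard with respect to polynomial-time many-one reductions: given a finite alphabet $\Sigma$, a nondeterministic finite automaton $T$ over $\Sigma$ (with language $\llbracket T\rrbracket$)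 and a rational number $\nu$, decide whether $$\overrightarrow{\mathrm{AH}}_{\mathrm{ned}}\big(\Sigma^*,\llbracket T\rrbracket\big)\le\nu .$$ Here $T$ is given by the numbers of its letters and states and the lists of its initial states, accepting states and transitions, letters and states being written in unary, and $\nu$ is given by its sign and the binary expansions of its numerator and denominator. -/

import Mathlib

open Filter Topology
open scoped NNReal ENNReal

namespace AsympHausdorff

/-! ### Normalized edit distance -/

section Words

variable {α : Type*}

/-- Edit operations over `α`: pairs in `(α ∪ {ε})²` other than `(ε, ε)`, where `none` is `ε`. -/
abbrev EditOp (α : Type*) : Type _ := {e : Option α × Option α // e ≠ (none, none)}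

open Classical in
/-- Uniform weight: a no-op `(a, a)` has weight `0`, every other edit operation has weight `1`. -/
noncomputable def EditOp.weight (e : EditOp α) : ℕ := if e.1.1 = e.1.2 then 0 else 1

/-- `p` is an edit path from `x` to `y`: the first components spell `x` and the second ones `y`. -/
def IsEditPath (p : List (EditOp α)) (x y : List α) : Prop :=
  (p.map fun e => e.1.1).reduceOption = x ∧ (p.map fun e => e.1.2).reduceOption = y

/-- The weight of an edit path is the sum of the weights of its operations. -/
noncomputable def pathWeight (p : List (EditOp α)) : ℕ := (p.map EditOp.weight).sum

/-- The cost of an edit path is its weight divided by its length (`0` for the empty path). -/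
noncomputable def pathCost (p : List (EditOp α)) : ℝ≥0 := (pathWeight p : ℝ≥0) / (p.length : ℝ≥0)

/-- The normalized edit distance: the minimal cost of an edit path from `x` to `y`.
The minimum is attained, see `ned_attained`. -/
noncomputable def ned (x y : List α) : ℝ≥0 := sInf {c | ∃ p, IsEditPath p x y ∧ pathCost p = c}

theorem exists_isEditPath (x y : List α) : ∃ p, IsEditPath p x y := by
  have h1 : ∀ l : List α, ∃ p : List (EditOp α), IsEditPath p [] l := by
    intro l
    induction l with
    | nil => exact ⟨[], rfl, rfl⟩
    | cons b l ih =>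
      obtain ⟨p, h, h'⟩ := ih
      exact ⟨⟨(none, some b), by simp⟩ :: p, h, congrArg (b :: ·) h'⟩
  induction x with
  | nil => exact h1 y
  | cons a x ih =>
    obtain ⟨p, h, h'⟩ := ih
    exact ⟨⟨(some a, none), by simp⟩ :: p, congrArg (a :: ·) h, h'⟩

theorem IsEditPath.length_le {p : List (EditOp α)} {x y : List α} (h : IsEditPath p x y) :
    p.length ≤ x.length + y.length := by
  induction p generalizing x y with
  | nil => simp
  | cons e p ih =>
    obtain ⟨h, h'⟩ := h
    have := ih ⟨rfl, rfl⟩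
    obtain ⟨⟨a, b⟩, he⟩ := e
    subst h h'
    cases a <;> cases b <;> first | exact absurd rfl he | skip
    all_goals
      simp only [List.map_cons, List.reduceOption_cons_of_some,
        List.reduceOption_cons_of_none, List.length_cons]
      omega

theorem pathWeight_le (p : List (EditOp α)) : pathWeight p ≤ p.length := by
  induction p with
  | nil => simp [pathWeight]
  | cons e p ih =>
    have : e.weight ≤ 1 := by unfold EditOp.weight; split <;> simp
    simp only [pathWeight, List.map_cons, List.sum_cons, List.length_cons] at ih ⊢
    omega

theorem ned_attained (x y : List α) : ∃ p, IsEditPath p x y ∧ pathCost p = ned x y := by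
  have hne : {c | ∃ p, IsEditPath p x y ∧ pathCost p = c}.Nonempty :=
    let ⟨p, hp⟩ := exists_isEditPath x y
    ⟨_, p, hp, rfl⟩
  have hfin : {c | ∃ p, IsEditPath p x y ∧ pathCost p = c}.Finite := by
    refine ((Set.finite_Iic (x.length + y.length, x.length + y.length)).image
      fun q : ℕ × ℕ => (q.1 : ℝ≥0) / (q.2 : ℝ≥0)).subset ?_
    rintro c ⟨p, hp, rfl⟩
    exact ⟨(pathWeight p, p.length),
      ⟨(pathWeight_le p).trans hp.length_le, hp.length_le⟩, rfl⟩
  exact hne.csInf_mem hfin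

end Words

/-! ### The asymptotic directional distance -/

section Lifting

variable {M : Type*}

/-- `inf_{y ∈ Y} d(x, y)`, the infimum being taken in `[0, sup d]`: the cut-off at `sup d` is only
effective for `Y = ∅`, where the value is `sup d`. -/
noncomputable def infDistTo (d : M → M → ℝ≥0) (x : M) (Y : Set M) : ℝ≥0∞ :=
  min (⨅ y ∈ Y, (d x y : ℝ≥0∞)) (⨆ (a : M) (b : M), (d a b : ℝ≥0∞))

/-- `sup_{x ∈ X, s(x) ≥ k} inf_{y ∈ Y} d(x, y)`, where the supremum of the empty set is `0`. -/
noncomputable def tailDist (s : M → ℝ≥0) (d : M → M → ℝ≥0) (X Y : Set M) (k : ℕ) : ℝ≥0∞ :=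
  ⨆ (x : M) (_ : x ∈ X) (_ : (k : ℝ≥0) ≤ s x), infDistTo d x Y

/-- The asymptotic directional distance from `X` to `Y` with respect to the size notion `s`:
`lim_{k → ∞} sup_{x ∈ X, s(x) ≥ k} inf_{y ∈ Y} d(x, y)`.
The limit always exists, see `tendsto_directedAH`. -/
noncomputable def directedAH (s : M → ℝ≥0) (d : M → M → ℝ≥0) (X Y : Set M) : ℝ≥0∞ :=
  limUnder atTop (tailDist s d X Y)

theorem infDistTo_of_nonempty (d : M → M → ℝ≥0) (x : M) {Y : Set M} (hY : Y.Nonempty) :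
    infDistTo d x Y = ⨅ y ∈ Y, (d x y : ℝ≥0∞) := by
  obtain ⟨y, hy⟩ := hY
  exact min_eq_left ((iInf₂_le y hy).trans
    (le_iSup_of_le x (le_iSup (fun b => (d x b : ℝ≥0∞)) y)))

theorem tendsto_directedAH (s : M → ℝ≥0) (d : M → M → ℝ≥0) (X Y : Set M) :
    Tendsto (tailDist s d X Y) atTop (𝓝 (directedAH s d X Y)) := by
  have h : Antitone (tailDist s d X Y) := fun k l hkl =>
    iSup₂_mono fun x _ => iSup_mono' fun hl =>
      ⟨(Nat.cast_le.2 hkl).trans hl, le_rfl⟩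
  exact tendsto_nhds_limUnder ⟨_, tendsto_atTop_iInf h⟩

end Lifting

/-- The asymptotic directional distance from `X` to `Y` obtained from the normalized edit distance,
the size of a word being its length. -/
noncomputable def directedAHned {α : Type*} (X Y : Set (List α)) : ℝ≥0∞ :=
  directedAH (fun w => (w.length : ℝ≥0)) ned X Y

/-! ### Instances of the decision problem and their binary encoding -/

/-- An NFA given explicitly, with alphabet `{0, …, numLetters - 1}`, set of states
`{0, …, numStates - 1}`, and lists of initial states, accepting states and transitions
`(p, a, q)`, the latter allowing to move from `p` to `q` when reading `a`. -/
structure FiniteNFA where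
  numLetters : ℕ
  numStates : ℕ
  start : List (Fin numStates)
  accept : List (Fin numStates)
  transitions : List (Fin numStates × Fin numLetters × Fin numStates)

/-- The automaton described by the data. -/
def FiniteNFA.toNFA (T : FiniteNFA) : NFA (Fin T.numLetters) (Fin T.numStates) where
  step p a := {q | (p, a, q) ∈ T.transitions}
  start := {q | q ∈ T.start}
  accept := {q | q ∈ T.accept}

/-- Self-delimiting unary encoding of a natural number. -/
def encodeUnary (n : ℕ) : List Bool := List.replicate n true ++ [false]

/-- Self-delimiting unary encoding of an element of `{0, …, n - 1}`. -/
def encodeFin {n : ℕ} (i : Fin n) : List Bool := encodeUnary i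

/-- Self-delimiting encoding of a list, given a self-delimiting encoding of its elements. -/
def encodeListWith {β : Type*} (e : β → List Bool) : List β → List Bool
  | [] => [false]
  | b :: l => true :: (e b ++ encodeListWith e l)

/-- Self-delimiting binary encoding of a natural number. -/
def encodeBinary (n : ℕ) : List Bool := encodeListWith (fun b => [b]) n.bits

/-- Encoding of a rational number by its sign and, in binary, its numerator and denominator. -/
def encodeRat (r : ℚ) : List Bool :=
  decide (r.num < 0) :: (encodeBinary r.num.natAbs ++ encodeBinary r.den)

/-- Encoding of an NFA; letters and states are written in unary. -/
def FiniteNFA.encode (T : FiniteNFA) : List Bool :=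
  encodeUnary T.numLetters ++ (encodeUnary T.numStates ++
    (encodeListWith encodeFin T.start ++
      (encodeListWith encodeFin T.accept ++
        encodeListWith (fun t => encodeFin t.1 ++ (encodeFin t.2.1 ++ encodeFin t.2.2))
          T.transitions)))

/-- Encoding of a pair of an NFA and a rational number. -/
def encodeInstance (I : FiniteNFA × ℚ) : List Bool := I.1.encode ++ encodeRat I.2

/-- The decision problem "given an NFA `T` over `Σ` and a rational `ν`, is the asymptotic
directional distance from `Σ*` to the language of `T` at most `ν`?", as a set of binary words. -/
def directedAHnedProblem : Language Bool :=
  {w | ∃ (T : FiniteNFA) (ν : ℚ), w = encodeInstance (T, ν) ∧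
    (directedAHned Set.univ {x | x ∈ T.toNFA.accepts} : EReal) ≤ ((ν : ℝ) : EReal)}

section Injectivity

/-- `e` is an injective, prefix-free encoding. -/
def SelfDelimiting {β : Type*} (e : β → List Bool) : Prop :=
  ∀ a b u v, e a ++ u = e b ++ v → a = b ∧ u = v

theorem selfDelimiting_unary : SelfDelimiting encodeUnary := by
  intro a
  induction a with
  | zero => intro b u v h; cases b <;> simp_all [encodeUnary, List.replicate_succ]
  | succ a ih =>
    intro b u v h
    cases b with
    | zero => simp [encodeUnary, List.replicate_succ] at h
    | succ b =>
      have := ih b u v (by simpa [encodeUnary, List.replicate_succ] using h)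
      simpa using this

theorem SelfDelimiting.list {β : Type*} {e : β → List Bool} (he : SelfDelimiting e) :
    SelfDelimiting (encodeListWith e) := by
  intro a
  induction a with
  | nil => intro b u v h; cases b <;> simp_all [encodeListWith]
  | cons x a ih =>
    intro b u v h
    cases b with
    | nil => simp [encodeListWith] at h
    | cons y b =>
      simp only [encodeListWith, List.cons_append, List.append_assoc, List.cons.injEq,
        true_and] at h
      obtain ⟨hx, h'⟩ := he _ _ _ _ h
      obtain ⟨hl, hu⟩ := ih _ _ _ h'
      exact ⟨by rw [hx, hl], hu⟩

theorem selfDelimiting_fin (n : ℕ) : SelfDelimiting (encodeFin (n := n)) := by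
  intro a b u v h
  obtain ⟨h1, h2⟩ := selfDelimiting_unary _ _ _ _ h
  exact ⟨Fin.ext h1, h2⟩

theorem selfDelimiting_binary : SelfDelimiting encodeBinary := by
  intro a b u v h
  have h1 : SelfDelimiting fun b : Bool => [b] := by
    intro a b u v h; simpa using h
  obtain ⟨h2, h3⟩ := h1.list _ _ _ _ h
  refine ⟨?_, h3⟩
  refine Nat.eq_of_testBit_eq fun i => ?_
  rw [Nat.testBit_eq_inth, Nat.testBit_eq_inth, h2]

/-- Different instances have different encodings. -/
theorem encodeInstance_injective : Function.Injective encodeInstance := by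
  rintro ⟨⟨k, n, s, f, t⟩, r⟩ ⟨⟨k', n', s', f', t'⟩, r'⟩ h
  simp only [encodeInstance, FiniteNFA.encode, List.append_assoc] at h
  obtain ⟨rfl, h⟩ := selfDelimiting_unary _ _ _ _ h
  obtain ⟨rfl, h⟩ := selfDelimiting_unary _ _ _ _ h
  obtain ⟨e1, h⟩ := (selfDelimiting_fin n).list _ _ _ _ h
  obtain ⟨e2, h⟩ := (selfDelimiting_fin n).list _ _ _ _ h
  have ht : SelfDelimiting fun t : Fin n × Fin k × Fin n =>
      encodeFin t.1 ++ (encodeFin t.2.1 ++ encodeFin t.2.2) := by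
    rintro ⟨a, b, c⟩ ⟨a', b', c'⟩ u v h
    simp only [List.append_assoc] at h
    obtain ⟨ha, h⟩ := selfDelimiting_fin n _ _ _ _ h
    obtain ⟨hb, h⟩ := selfDelimiting_fin k _ _ _ _ h
    obtain ⟨hc, h⟩ := selfDelimiting_fin n _ _ _ _ h
    exact ⟨by rw [ha, hb, hc], h⟩
  obtain ⟨e3, h⟩ := ht.list _ _ _ _ h
  simp only [encodeRat, List.cons.injEq, decide_eq_decide] at h
  obtain ⟨hs, h⟩ := h
  obtain ⟨hn, h⟩ := selfDelimiting_binary _ _ _ _ h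
  obtain ⟨hd, -⟩ := selfDelimiting_binary _ _ [] [] (by simpa using h)
  have e4 : r = r' := Rat.ext (by omega) hd
  rw [e1, e2, e3, e4]

end Injectivity

/-! ### Polynomial space, polynomial-time reductions, hardness -/

/-- A deterministic single-tape Turing machine with binary input and a two-way infinite tape. The
machine halts when `δ` is undefined, and then accepts if and only if its state is accepting. -/
structure TapeMachine where
  /-- The finite set of states. -/
  Q : Type
  [finQ : Fintype Q]
  /-- The finite tape alphabet. -/
  A : Type
  [finA : Fintype A]
  /-- The input bits, as tape symbols. -/
  inputSym : Bool ↪ A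
  blank : A
  blank_ne : ∀ b, inputSym b ≠ blank
  start : Q
  accept : Set Q
  /-- New state, symbol written, and direction of the move. -/
  δ : Q → A → Option (Q × A × Turing.Dir)

namespace TapeMachine

/-- A configuration: state, head position and tape contents. -/
structure Cfg (M : TapeMachine) where
  state : M.Q
  head : ℤ
  tape : ℤ → M.A

/-- One step of the machine; `none` if the machine has halted. -/
def step (M : TapeMachine) (c : M.Cfg) : Option M.Cfg :=
  (M.δ c.state (c.tape c.head)).map fun (q, a, dir) =>
    { state := q
      head := match dir with
        | .left => c.head - 1
        | .right => c.head + 1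
      tape := Function.update c.tape c.head a }

/-- The initial configuration: the input `x` is on the cells `0, …, |x| - 1`, all the other cells
are blank, and the head is on the cell `0`. -/
def init (M : TapeMachine) (x : List Bool) : M.Cfg where
  state := M.start
  head := 0
  tape
    | .ofNat i => (x[i]?).elim M.blank M.inputSym
    | .negSucc _ => M.blank

/-- `M` decides `L` in space `s`: on each input `x`, the head never leaves the cells
`-s(|x|), …, s(|x|)`, and `M` halts, accepting if and only if `x ∈ L`. -/
def DecidesInSpace (M : TapeMachine) (L : Language Bool) (s : ℕ → ℕ) : Prop :=
  ∀ x : List Bool,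
    (∀ c, StateTransition.Reaches M.step (M.init x) c → c.head.natAbs ≤ s x.length) ∧
    ∃ c, StateTransition.Reaches M.step (M.init x) c ∧ M.step c = none ∧
      (c.state ∈ M.accept ↔ x ∈ L)

end TapeMachine

/-- The class of the languages decidable in polynomial space. -/
def PSPACE : Set (Language Bool) :=
  {L | ∃ (M : TapeMachine) (p : Polynomial ℕ), M.DecidesInSpace L fun n => p.eval n}

/-- Polynomial-time many-one (Karp) reducibility of `L` to `L'`. -/
def PolyTimeReducible (L L' : Language Bool) : Prop :=
  ∃ f : List Bool → List Bool, Nonempty (Turing.TM2ComputableInPolyTime id id f) ∧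
    ∀ x, x ∈ L ↔ f x ∈ L'

/-- Every language in `PSPACE` is reducible to `L` in polynomial time. -/
def PSPACEHard (L : Language Bool) : Prop := ∀ L' ∈ PSPACE, PolyTimeReducible L' L

end AsympHausdorff

/-!
PSPACE-hardness is proved with the threshold `ν = 0`. Let `M` decide a language in polynomial space,
and let `x` be an input. A computation of `M` on `x` is written as a word with one letter
`(h, q, a)` per configuration: position of the head, state, symbol read. As letters and states of the
automaton may be as numerous as the cells used, the tape contents need not be written down: a word
describes a computation that halts and rejects if and only if
* each letter has the head and the state that result from the previous letter,
* each letter reads what was last written on its cell, or what was there initially,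
* the computation does not stop before a halting configuration, and does not reach an accepting one.

An automaton with polynomially many states can guess a violation of one of these conditions and
verify it (`TapeMachine.Step`). It reads words in which such blocks are separated by `sharp`, and
wants errors in all blocks other than the first and the last one, except that it notices an error at
the end of a block only when it reads the separator, and then does not look for an error in the next
block.

* If `M` accepts `x`, there is no correct block, the automaton accepts all words
  (`TapeMachine.exists_run_of_accepts`), and the distance is `0`.
* If `M` rejects `x`, let `w` be the correct block. The word `v = #w#w#` is no factor of an accepted
  word (`TapeMachine.exists_forbidden_factor`). Hence an edit path from `v ^ n` to an accepted word
  has weight at least `1` on each copy of `v`, so that its cost is at least `1 / (|v| + 1)`, for all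
  `n` (`IsEditPath.length_le_mul_pathWeight`), and the distance is positive.

It remains to see that the automaton can be printed in polynomial time by a `TM2` machine. This is
done by a program in a small language of loops over stacks (`Cmd`), for which `Cmd.Exec.simulates`
provides the compilation. Cells are numbered so that all the numbers of letters and states occurring
in transitions are linear forms in two loop variables `j < i`, each of them running through the
cells; such numbers are printed in unary by `Cmd.emits_unary`, and the program for the whole list of
transitions is assembled from closure properties of what can be printed.
-/

namespace AsympHausdorff

/-! ### A language of stack programs and its compilation to `TM2` machines -/

/-- Programs acting on finitely many stacks of bits, indexed by `K`. -/
inductive Cmd (K : Type) : Type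
  /-- Do nothing. -/
  | skip : Cmd K
  /-- Push a bit on a stack. -/
  | push (k : K) (b : Bool) : Cmd K
  /-- Sequential composition. -/
  | seq (c d : Cmd K) : Cmd K
  /-- As long as the stack `k` is not empty, pop a bit from it, and run `c` if this bit is `true`
  and `d` if it is `false`. -/
  | loop (k : K) (c d : Cmd K) : Cmd K

namespace Cmd

variable {K : Type} [DecidableEq K]

/-- `Exec c s s' t`: started with the stacks `s`, the program `c` terminates with the stacks `s'`
after at most `t` steps. -/
inductive Exec : Cmd K → (K → List Bool) → (K → List Bool) → ℕ → Prop
  | skip (s) : Exec skip s s 1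
  | push (k b s) : Exec (push k b) s (Function.update s k (b :: s k)) 1
  | seq {c d s s' s'' t t'} : Exec c s s' t → Exec d s' s'' t' → Exec (seq c d) s s'' (t + t')
  | loop_nil {k c d s} : s k = [] → Exec (loop k c d) s s 1
  | loop_cons {k c d s s' s'' t t' b l} : s k = b :: l →
      Exec (bif b then c else d) (Function.update s k l) s' t →
      Exec (loop k c d) s' s'' t' → Exec (loop k c d) s s'' (t + t' + 1)
  | mono {c s s' t t'} : Exec c s s' t → t ≤ t' → Exec c s s' t'

/-- The rule for loops whose iterations have a uniform time bound. Here `f d r` are the contents of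
the stacks when the bits `d` (last one first) have been popped and the bits `r` remain. -/
theorem Exec.loop_list {k : K} {c d : Cmd K} {l : List Bool} {T : ℕ}
    (f : List Bool → List Bool → K → List Bool) (hf : ∀ u r, f u r k = r)
    (h : ∀ u b r, l = u.reverse ++ b :: r →
      Exec (bif b then c else d) (Function.update (f u (b :: r)) k r) (f (b :: u) r) T) :
    Exec (Cmd.loop k c d) (f [] l) (f l.reverse []) (l.length * (T + 1) + 1) := by
  suffices H : ∀ r u, l = u.reverse ++ r →
      Exec (Cmd.loop k c d) (f u r) (f l.reverse []) (r.length * (T + 1) + 1) from H l [] rfl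
  intro r
  induction r with
  | nil =>
    intro u hu
    have : l.reverse = u := by simp [hu]
    rw [this]
    exact (Exec.loop_nil (hf _ _)).mono (by simp)
  | cons b r ih =>
    intro u hu
    refine (Exec.loop_cons (hf _ _) (h u b r hu) (ih (b :: u) (by simp [hu]))).mono ?_
    simp only [List.length_cons, Nat.add_mul]
    omega

/-- The rule for loops over a unary counter; `f i r` are the contents of the stacks when `i`
iterations have been done and `r` remain. -/
theorem Exec.loop_unary {k : K} {c d : Cmd K} {n T : ℕ}
    (f : ℕ → ℕ → K → List Bool) (hf : ∀ i r, f i r k = List.replicate r true)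
    (h : ∀ i r, n = i + r + 1 →
      Exec c (Function.update (f i (r + 1)) k (List.replicate r true)) (f (i + 1) r) T) :
    Exec (loop k c d) (f 0 n) (f n 0) (n * (T + 1) + 1) := by
  suffices H : ∀ r i, n = i + r →
      Exec (Cmd.loop k c d) (f i r) (f n 0) (r * (T + 1) + 1) from H n 0 (by simp)
  intro r
  induction r with
  | zero =>
    intro i hi
    obtain rfl : n = i := by simpa using hi
    exact (Exec.loop_nil (hf _ _)).mono (by simp)
  | succ r ih =>
    intro i hi
    refine (Exec.loop_cons (b := true) (l := List.replicate r true) (hf _ _)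
      (h i r (by omega)) (ih (i + 1) (by omega))).mono ?_
    simp only [Nat.add_mul]
    omega

/-- The labels of the machine compiled from a program. -/
def Lab : Cmd K → Type
  | skip => Unit
  | push _ _ => Unit
  | seq c d => Lab c ⊕ Lab d
  | loop _ c d => Option (Lab c ⊕ Lab d)

/-- The label at which a program starts. -/
def entry : (c : Cmd K) → Lab c
  | skip => ()
  | push _ _ => ()
  | seq c _ => Sum.inl (entry c)
  | loop _ _ _ => none

noncomputable instance fintypeLab : (c : Cmd K) → Fintype (Lab c)
  | skip => inferInstanceAs (Fintype Unit)
  | push _ _ => inferInstanceAs (Fintype Unit)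
  | seq c d =>
    letI := fintypeLab c
    letI := fintypeLab d
    inferInstanceAs (Fintype (Lab c ⊕ Lab d))
  | loop _ c d =>
    letI := fintypeLab c
    letI := fintypeLab d
    inferInstanceAs (Fintype (Option (Lab c ⊕ Lab d)))

/-- The compiled program, as a part of a machine with labels `Λ` in which its labels are named by
`emb` and which continues at the label `exit`. The internal state of the machine only serves to
branch on the bit popped last. -/
def code {Λ : Type} : (c : Cmd K) → (emb : Lab c → Λ) → (exit : Λ) → Lab c →
    Turing.TM2.Stmt (fun _ : K => Bool) Λ (Option Bool)
  | skip, _, exit, _ => .goto fun _ => exit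
  | push k b, _, exit, _ => .push k (fun _ => b) (.goto fun _ => exit)
  | seq c d, emb, exit, l => match l with
    | .inl l => code c (fun l => emb (Sum.inl l)) (emb (Sum.inr (entry d))) l
    | .inr l => code d (fun l => emb (Sum.inr l)) exit l
  | loop k c d, emb, exit, l => match l with
    | none => .pop k (fun _ o => o) (.goto fun v => v.elim exit fun b =>
        bif b then emb (some (Sum.inl (entry c))) else emb (some (Sum.inr (entry d))))
    | some (.inl l) => code c (fun l => emb (some (Sum.inl l))) (emb none) l
    | some (.inr l) => code d (fun l => emb (some (Sum.inr l))) (emb none) l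

/-- `m` steps of a step function lead from one configuration to another one. -/
def StepsTo {σ : Type*} (f : σ → Option σ) (m : ℕ) (a b : σ) : Prop :=
  (flip Bind.bind f)^[m] (some a) = some b

theorem StepsTo.trans {σ : Type*} {f : σ → Option σ} {m n : ℕ} {a b c : σ}
    (h : StepsTo f m a b) (h' : StepsTo f n b c) : StepsTo f (m + n) a c := by
  unfold StepsTo at *
  rw [Nat.add_comm, Function.iterate_add_apply, h, h']

theorem StepsTo.one {σ : Type*} {f : σ → Option σ} {a b : σ} (h : f a = some b) :
    StepsTo f 1 a b := by
  simpa [StepsTo, flip] using h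

/-- The compiled program simulates the source program. -/
theorem Exec.simulates {c : Cmd K} {s s' : K → List Bool} {t : ℕ} (h : Exec c s s' t) :
    ∀ {Λ : Type} (m : Λ → Turing.TM2.Stmt (fun _ : K => Bool) Λ (Option Bool))
      (emb : Lab c → Λ) (exit : Λ), (∀ l, m (emb l) = code c emb exit l) → ∀ v,
      ∃ v', ∃ n ≤ t, StepsTo (Turing.TM2.step m) n ⟨some (emb (entry c)), v, s⟩
        ⟨some exit, v', s'⟩ := by
  induction h with
  | skip s =>
    intro Λ m emb exit hm v
    refine ⟨v, 1, le_rfl, .one ?_⟩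
    simp [hm, code]
  | push k b s =>
    intro Λ m emb exit hm v
    refine ⟨v, 1, le_rfl, .one ?_⟩
    simp [hm, code]
  | @seq c d s s' s'' t t' _ _ ih ih' =>
    intro Λ m emb exit hm v
    obtain ⟨v1, n1, hn1, h1⟩ := ih m (fun l => emb (Sum.inl l)) (emb (Sum.inr (entry d)))
      (fun l => hm (Sum.inl l)) v
    obtain ⟨v2, n2, hn2, h2⟩ := ih' m (fun l => emb (Sum.inr l)) exit
      (fun l => hm (Sum.inr l)) v1
    exact ⟨v2, n1 + n2, by omega, h1.trans h2⟩
  | @loop_nil k c d s hs =>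
    intro Λ m emb exit hm v
    refine ⟨none, 1, le_rfl, .one ?_⟩
    have := hm none
    have e : Function.update s k [] = s := by rw [← hs]; simp
    simp [entry, this, code, hs, e]
  | @loop_cons k c d s s' s'' t t' b l hs _ _ ih ih' =>
    intro Λ m emb exit hm v
    have h0 : StepsTo (Turing.TM2.step m) 1 ⟨some (emb (entry (loop k c d))), v, s⟩
        ⟨some (bif b then emb (some (Sum.inl (entry c))) else emb (some (Sum.inr (entry d)))),
          some b, Function.update s k l⟩ := by
      refine .one ?_
      have := hm none
      simp [entry, this, code, hs]
    obtain ⟨v1, n1, hn1, h1⟩ : ∃ v', ∃ n ≤ t, StepsTo (Turing.TM2.step m) n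
        ⟨some (bif b then emb (some (Sum.inl (entry c))) else emb (some (Sum.inr (entry d)))),
          some b, Function.update s k l⟩ ⟨some (emb none), v', s'⟩ := by
      cases b
      · exact ih m (fun l => emb (some (Sum.inr l))) (emb none) (fun l => hm (some (Sum.inr l))) _
      · exact ih m (fun l => emb (some (Sum.inl l))) (emb none) (fun l => hm (some (Sum.inl l))) _
    obtain ⟨v2, n2, hn2, h2⟩ := ih' m emb exit hm v1
    exact ⟨v2, 1 + n1 + n2, by omega, (h0.trans h1).trans h2⟩
  | mono _ htt' ih =>
    intro Λ m emb exit hm v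
    obtain ⟨v', n, hn, h⟩ := ih m emb exit hm v
    exact ⟨v', n, hn.trans htt', h⟩

variable [Fintype K]

/-- The machine compiled from a program, with input stack `k₀` and output stack `k₁`. -/
noncomputable def machine (c : Cmd K) (k₀ k₁ : K) : Turing.FinTM2 where
  K := K
  k₀ := k₀
  k₁ := k₁
  Γ _ := Bool
  Λ := Option (Lab c)
  main := some (entry c)
  σ := Option Bool
  initialState := none
  m
    | none => .load (fun _ => none) .halt
    | some l => code c some none l

theorem dite_eq_update {K : Type} [DecidableEq K] (k₀ k : K) (x : List Bool)
    (h : k = k₀ → List Bool = List Bool) :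
    (if e : k = k₀ then (h e).mpr x else []) = Function.update (fun _ => []) k₀ x k := by
  by_cases hk : k = k₀ <;> simp [hk]

theorem initList_machine (c : Cmd K) (k₀ k₁ : K) (x : List Bool) :
    Turing.initList (machine c k₀ k₁) x =
      ⟨some (some (entry c)), none, Function.update (fun _ => []) k₀ x⟩ := by
  refine congrArg (Turing.TM2.Cfg.mk _ _) (funext fun k => ?_)
  exact dite_eq_update k₀ k x fun _ => rfl

theorem haltList_machine (c : Cmd K) (k₀ k₁ : K) (x : List Bool) :
    Turing.haltList (machine c k₀ k₁) x =
      ⟨none, none, Function.update (fun _ => []) k₁ x⟩ := by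
  refine congrArg (Turing.TM2.Cfg.mk _ _) (funext fun k => ?_)
  exact dite_eq_update k₁ k x fun _ => rfl

/-- A function that is computed by a program within polynomial time is computed by a Turing machine
within polynomial time. -/
theorem computableInPolyTime (c : Cmd K) (k₀ k₁ : K) (f : List Bool → List Bool)
    (P : Polynomial ℕ)
    (h : ∀ x, Exec c (Function.update (fun _ => []) k₀ x)
      (Function.update (fun _ => []) k₁ (f x)) (P.eval x.length)) :
    Nonempty (Turing.TM2ComputableInPolyTime id id f) := by
  have key : ∀ x : List Bool, ∃ n ≤ P.eval x.length + 1, StepsTo (machine c k₀ k₁).step n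
      (Turing.initList (machine c k₀ k₁) x) (Turing.haltList (machine c k₀ k₁) (f x)) := by
    intro x
    obtain ⟨v, n, hn, hs⟩ := (h x).simulates (machine c k₀ k₁).m some none (fun _ => rfl) none
    refine ⟨n + 1, Nat.succ_le_succ hn, StepsTo.trans
      (b := ⟨some none, v, Function.update (fun _ => []) k₁ (f x)⟩) ?_ ?_⟩
    · rw [initList_machine]
      exact hs
    · rw [haltList_machine]
      exact .one rfl
  choose n hn hs using key
  exact ⟨{
    tm := machine c k₀ k₁
    inputAlphabet := Equiv.refl _
    outputAlphabet := Equiv.refl _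
    time := P + 1
    outputsFun := fun x =>
      { steps := n x
        evals_in_steps := by
          have e : ∀ l : List Bool, l.map (Equiv.refl Bool).invFun = l := fun l => l.map_id
          have := hs x
          unfold StepsTo at this
          exact (congrArg (fun l => (flip Bind.bind (machine c k₀ k₁).step)^[n x]
            (some (Turing.initList (machine c k₀ k₁) l))) (e x)).trans
            (this.trans (congrArg (fun l => some (Turing.haltList (machine c k₀ k₁) l))
              (e (f x)).symm))
        steps_le_m := (hn x).trans_eq (by rw [Polynomial.eval_add, Polynomial.eval_one]; rfl) } }⟩

end Cmd

/-! ### Programs that print -/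

theorem evalNat_mono (P : Polynomial ℕ) {m n : ℕ} (h : m ≤ n) : P.eval m ≤ P.eval n := by
  induction P using Polynomial.induction_on' with
  | add p q hp hq => simpa using Nat.add_le_add hp hq
  | monomial k a => simpa using Nat.mul_le_mul_left a (Nat.pow_le_pow_left h k)

/-- The stacks of the programs below: input and output, two copies `a` and `c` of the unary number of
cells on either side of the input (at first, `a` is the length of the input), the unary loop variables
`i` and `j`, the control `d` of the inner loop, and `t` for restoring what a loop has consumed. -/
inductive Reg : Type
  | inp | out | a | c | i | d | j | t
  deriving DecidableEq

instance : Fintype Reg where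
  elems := {.inp, .out, .a, .c, .i, .d, .j, .t}
  complete k := by cases k <;> decide

/-- The contents of all the stacks. -/
structure Regs where
  inp : List Bool := []
  out : List Bool := []
  a : List Bool := []
  c : List Bool := []
  i : List Bool := []
  d : List Bool := []
  j : List Bool := []
  t : List Bool := []

namespace Regs

/-- The contents of the stacks, as a function of the stack. -/
def st (r : Regs) : Reg → List Bool
  | .inp => r.inp
  | .out => r.out
  | .a => r.a
  | .c => r.c
  | .i => r.i
  | .d => r.d
  | .j => r.j
  | .t => r.t

variable (r : Regs) (l : List Bool)

@[simp] theorem st_inp : r.st .inp = r.inp := rfl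
@[simp] theorem st_out : r.st .out = r.out := rfl
@[simp] theorem st_a : r.st .a = r.a := rfl
@[simp] theorem st_c : r.st .c = r.c := rfl
@[simp] theorem st_i : r.st .i = r.i := rfl
@[simp] theorem st_d : r.st .d = r.d := rfl
@[simp] theorem st_j : r.st .j = r.j := rfl
@[simp] theorem st_t : r.st .t = r.t := rfl

@[simp] theorem update_inp : Function.update r.st .inp l = st { r with inp := l } := by
  funext k; cases k <;> rfl
@[simp] theorem update_out : Function.update r.st .out l = st { r with out := l } := by
  funext k; cases k <;> rfl
@[simp] theorem update_a : Function.update r.st .a l = st { r with a := l } := by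
  funext k; cases k <;> rfl
@[simp] theorem update_c : Function.update r.st .c l = st { r with c := l } := by
  funext k; cases k <;> rfl
@[simp] theorem update_i : Function.update r.st .i l = st { r with i := l } := by
  funext k; cases k <;> rfl
@[simp] theorem update_d : Function.update r.st .d l = st { r with d := l } := by
  funext k; cases k <;> rfl
@[simp] theorem update_j : Function.update r.st .j l = st { r with j := l } := by
  funext k; cases k <;> rfl
@[simp] theorem update_t : Function.update r.st .t l = st { r with t := l } := by
  funext k; cases k <;> rfl

end Regs

namespace Cmd

open List (replicate)

variable {K : Type} [DecidableEq K]

theorem Exec.cast {c : Cmd K} {s s' s₀ s₀' : K → List Bool} {t t₀ : ℕ} (h : Exec c s s' t)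
    (hs : s = s₀) (hs' : s' = s₀') (ht : t ≤ t₀) : Exec c s₀ s₀' t₀ :=
  hs ▸ hs' ▸ h.mono ht

/-- Put a word on top of a stack. -/
def pushAll (k : K) : List Bool → Cmd K
  | [] => skip
  | b :: l => seq (pushAll k l) (push k b)

theorem exec_pushAll (k : K) (l : List Bool) (s : K → List Bool) :
    Exec (pushAll k l) s (Function.update s k (l ++ s k)) (l.length + 1) := by
  induction l with
  | nil => exact (Exec.skip s).cast rfl (by simp) le_rfl
  | cons b l ih => exact (ih.seq (.push k b _)).cast rfl (by simp) (by simp)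

/-- Empty a stack. -/
def clear (k : K) : Cmd K := loop k skip skip

theorem exec_clear (k : K) (s : K → List Bool) :
    Exec (clear k) s (Function.update s k []) ((s k).length * 2 + 1) := by
  refine (Exec.loop_list (l := s k) (T := 1) (d := skip) (fun _ r => Function.update s k r)
    (by simp) (fun u b r _ => ?_)).cast (by simp) rfl le_rfl
  have : (bif b then skip else skip : Cmd K) = skip := by cases b <;> rfl
  rw [this, Function.update_idem]
  exact .skip _

/-- Move a stack to another one; this reverses the word. -/
def move (k k' : K) : Cmd K := loop k (push k' true) (push k' false)

theorem exec_move {k k' : K} (h : k ≠ k') (s : K → List Bool) :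
    Exec (move k k') s (Function.update (Function.update s k []) k' ((s k).reverse ++ s k'))
      ((s k).length * 2 + 1) := by
  refine (Exec.loop_list (l := s k) (T := 1) (d := push k' false)
    (fun u r => Function.update (Function.update s k r) k' (u ++ s k'))
    (by simp [h]) (fun u b r _ => ?_)).cast (by simp) rfl le_rfl
  have : (bif b then push k' true else push k' false) = push k' b := by cases b <;> rfl
  rw [this]
  refine (Exec.push k' b _).cast rfl ?_ le_rfl
  rw [Function.update_comm h]
  simp [h.symm, Function.update_comm h]

theorem exec_move_unary {k k' : K} (h : k ≠ k') (s : K → List Bool) {n : ℕ}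
    (hn : s k = replicate n true) (h0 : s k' = []) :
    Exec (move k k') s (Function.update (Function.update s k []) k' (replicate n true))
      (n * 2 + 1) := by
  simpa [hn, h0] using exec_move h s

/-- `g i j` can be printed (in front of what has been printed before) by a program, within
polynomial time, if `i` and `j` are given in unary on the stacks of these names. -/
def Emits (g : ℕ → ℕ → List Bool) : Prop :=
  ∃ (c : Cmd Reg) (P : Polynomial ℕ), ∀ (r : Regs) (i j : ℕ),
    r.i = replicate i true → r.j = replicate j true → r.t = [] →
    Exec c r.st (Regs.st { r with out := g i j ++ r.out }) (P.eval (i + j))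

theorem emits_const (l : List Bool) : Emits fun _ _ => l :=
  ⟨pushAll .out l, Polynomial.C (l.length + 1), fun r i j _ _ _ =>
    (exec_pushAll .out l r.st).cast rfl (by simp) (by simp)⟩

theorem Emits.append {g g' : ℕ → ℕ → List Bool} (h : Emits g) (h' : Emits g') :
    Emits fun i j => g i j ++ g' i j := by
  obtain ⟨c, P, h⟩ := h
  obtain ⟨c', P', h'⟩ := h'
  refine ⟨seq c' c, P' + P, fun r i j hi hj ht => ?_⟩
  exact ((h' r i j hi hj ht).seq (h _ i j hi hj ht)).cast rfl (by simp) (by simp)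

theorem emits_mul_i (a : ℕ) : Emits fun i _ => replicate (a * i) true := by
  refine ⟨seq (loop .i (seq (pushAll .out (replicate a true)) (push .t true)) skip) (move .t .i),
    Polynomial.C (a + 5) * .X + 2, ?_⟩
  rintro ⟨inp, out, ra, rc, ri, rd, rj, rt⟩ i j hi hj ht
  obtain rfl : ri = _ := hi
  obtain rfl : rj = _ := hj
  obtain rfl : rt = _ := ht
  refine ((Exec.loop_unary (n := i) (T := a + 2) (fun u v => Regs.st
    ⟨inp, replicate (a * u) true ++ out, ra, rc, replicate v true, rd, replicate j true, replicate u true⟩)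
    (fun _ _ => rfl) fun u v _ => ?_).seq
    (exec_move_unary (n := i) (by decide) _ (by simp) (by simp))).cast ?_ ?_ ?_
  · rw [Regs.update_i]
    refine ((exec_pushAll _ _ _).seq (.push _ _ _)).cast rfl ?_ (by simp)
    rw [Nat.mul_succ, Nat.add_comm (a * u)]
    simp [List.replicate_succ, List.replicate_add, -List.replicate_append_replicate]
  · simp
  · simp
  · simp
    nlinarith

theorem emits_mul_j (a : ℕ) : Emits fun _ j => replicate (a * j) true := by
  refine ⟨seq (loop .j (seq (pushAll .out (replicate a true)) (push .t true)) skip) (move .t .j),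
    Polynomial.C (a + 5) * .X + 2, ?_⟩
  rintro ⟨inp, out, ra, rc, ri, rd, rj, rt⟩ i j hi hj ht
  obtain rfl : ri = _ := hi
  obtain rfl : rj = _ := hj
  obtain rfl : rt = _ := ht
  refine ((Exec.loop_unary (n := j) (T := a + 2) (fun u v => Regs.st
    ⟨inp, replicate (a * u) true ++ out, ra, rc, replicate i true, rd, replicate v true, replicate u true⟩)
    (fun _ _ => rfl) fun u v _ => ?_).seq
    (exec_move_unary (n := j) (by decide) _ (by simp) (by simp))).cast ?_ ?_ ?_
  · rw [Regs.update_j]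
    refine ((exec_pushAll _ _ _).seq (.push _ _ _)).cast rfl ?_ (by simp)
    rw [Nat.mul_succ, Nat.add_comm (a * u)]
    simp [List.replicate_succ, List.replicate_add, -List.replicate_append_replicate]
  · simp
  · simp
  · simp
    nlinarith

/-- Unary numbers given by a linear form in `i` and `j` can be printed. -/
theorem emits_unary {φ : ℕ → ℕ → ℕ} (a b c : ℕ) (h : ∀ i j, φ i j = a * i + b * j + c) :
    Emits fun i j => encodeUnary (φ i j) := by
  have := (((emits_mul_i a).append (emits_mul_j b)).append
    (emits_const (replicate c true))).append (emits_const [false])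
  simpa only [encodeUnary, h, List.replicate_add] using this

/-- `g (n - 1) ++ ⋯ ++ g 0`. -/
def catBelow {β : Type*} (g : ℕ → List β) : ℕ → List β
  | 0 => []
  | n + 1 => g n ++ catBelow g n

/-- `g i` can be printed by a program, within polynomial time, if `i` is given in unary on the stack
of this name and some other stacks may be used. -/
def EmitsAt (g : ℕ → List Bool) : Prop :=
  ∃ (c : Cmd Reg) (P : Polynomial ℕ), ∀ (r : Regs) (i : ℕ),
    r.i = replicate i true → r.j = [] → r.t = [] → r.d = [] →
    Exec c r.st (Regs.st { r with out := g i ++ r.out }) (P.eval i)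

theorem Emits.emitsAt {g : ℕ → ℕ → List Bool} (h : Emits g) : EmitsAt fun i => g i 0 := by
  obtain ⟨c, P, h⟩ := h
  exact ⟨c, P, fun r i hi hj ht _ => h r i 0 hi hj ht⟩

theorem EmitsAt.append {g g' : ℕ → List Bool} (h : EmitsAt g) (h' : EmitsAt g') :
    EmitsAt fun i => g i ++ g' i := by
  obtain ⟨c, P, h⟩ := h
  obtain ⟨c', P', h'⟩ := h'
  refine ⟨seq c' c, P' + P, fun r i hi hj ht hd => ?_⟩
  exact ((h' r i hi hj ht hd).seq (h _ i hi hj ht hd)).cast rfl (by simp) (by simp)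

/-- An inner loop over `j < i`. -/
theorem Emits.emitsAt_catBelow {g : ℕ → ℕ → List Bool} (h : Emits g) :
    EmitsAt fun i => catBelow (g i) i := by
  obtain ⟨c, P, h⟩ := h
  refine ⟨seq (loop .i (seq (push .t true) (push .d true)) skip) (seq (move .t .i)
    (seq (loop .d (seq c (push .j true)) skip) (clear .j))),
    .X * (P.comp (2 * .X) + 9) + 4, ?_⟩
  rintro ⟨inp, out, ra, rc, ri, rd, rj, rt⟩ i hi hj ht hd
  obtain rfl : ri = _ := hi
  obtain rfl : rj = _ := hj
  obtain rfl : rt = _ := ht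
  obtain rfl : rd = _ := hd
  have h1 := Exec.loop_unary (c := seq (push Reg.t true) (push .d true)) (k := .i) (d := skip)
    (n := i) (T := 2) (fun u v => Regs.st
      ⟨inp, out, ra, rc, replicate v true, replicate u true, [], replicate u true⟩)
    (fun _ _ => rfl) fun u v _ => by
      rw [Regs.update_i]
      exact ((Exec.push _ _ _).seq (.push _ _ _)).cast rfl (by simp [List.replicate_succ]) le_rfl
  have h2 := exec_move_unary (n := i) (k := Reg.t) (k' := .i) (by decide)
    (Regs.st ⟨inp, out, ra, rc, [], replicate i true, [], replicate i true⟩) rfl rfl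
  have h3 := Exec.loop_unary (c := seq c (push Reg.j true)) (k := .d) (d := skip) (n := i)
    (T := P.eval (2 * i) + 1) (fun u v => Regs.st
      ⟨inp, catBelow (g i) u ++ out, ra, rc, replicate i true, replicate v true,
        replicate u true, []⟩)
    (fun _ _ => rfl) fun u v huv => by
      rw [Regs.update_d]
      exact ((h _ i u rfl rfl rfl).seq (.push _ _ _)).cast rfl
        (by simp [List.replicate_succ, catBelow])
        (Nat.add_le_add_right (evalNat_mono _ (by omega)) 1)
  have h4 := exec_clear Reg.j (Regs.st
    ⟨inp, catBelow (g i) i ++ out, ra, rc, replicate i true, [], replicate i true, []⟩)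
  refine (h1.seq ((h2.cast rfl rfl le_rfl).seq ((h3.cast ?_ rfl le_rfl).seq
    (h4.cast rfl rfl le_rfl)))).cast ?_ ?_ ?_
  · simp [catBelow]
  · simp
  · simp
  · simp
    nlinarith

/-! ### Programs that evaluate polynomials, and the overall program -/

/-- The stack `i` is multiplied by the stack `a`, both being unary. -/
def mulStep : Cmd Reg :=
  seq (loop .i (seq (loop .a (seq (push .d true) (push .c true)) skip) (move .d .a)) skip)
    (move .c .i)

theorem exec_mulStep (inp out rj rt : List Bool) (m n : ℕ) :
    Exec mulStep (Regs.st ⟨inp, out, replicate n true, [], replicate m true, [], rj, rt⟩)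
      (Regs.st ⟨inp, out, replicate n true, [], replicate (m * n) true, [], rj, rt⟩)
      (m * (5 * n + 3) + 1 + (m * n * 2 + 1)) := by
  have h1 : ∀ u v, Exec (loop .a (seq (push .d true) (push .c true)) skip)
      (Regs.st ⟨inp, out, replicate n true, replicate (u * n) true, replicate v true, [], rj, rt⟩)
      (Regs.st ⟨inp, out, [], replicate ((u + 1) * n) true, replicate v true, replicate n true,
        rj, rt⟩) (n * 3 + 1) := by
    intro u v
    refine (Exec.loop_unary (n := n) (T := 2) (fun u' v' => Regs.st ⟨inp, out, replicate v' true,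
      replicate (u * n + u') true, replicate v true, replicate u' true, rj, rt⟩)
      (fun _ _ => rfl) fun u' v' _ => ?_).cast (by simp) (by simp [Nat.succ_mul]) le_rfl
    rw [Regs.update_a]
    exact ((Exec.push _ _ _).seq (.push _ _ _)).cast rfl
      (by simp [List.replicate_succ, ← Nat.add_assoc]) le_rfl
  have h2 := Exec.loop_unary (k := .i) (c := seq _ (move .d .a)) (d := skip) (n := m)
    (T := 5 * n + 2) (fun u v => Regs.st
      ⟨inp, out, replicate n true, replicate (u * n) true, replicate v true, [], rj, rt⟩)
    (fun _ _ => rfl) fun u v _ => by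
      rw [Regs.update_i]
      exact ((h1 u v).seq (exec_move_unary (n := n) (by decide) _ rfl rfl)).cast rfl
        (by simp) (by omega)
  exact (h2.seq (exec_move_unary (n := m * n) (by decide) _ rfl rfl)).cast (by simp)
    (by simp) le_rfl

/-- Polynomials can be evaluated, by Horner's rule. -/
theorem exists_evalPolynomial (p : Polynomial ℕ) :
    ∃ (c : Cmd Reg) (P : Polynomial ℕ), ∀ (inp out rj rt : List Bool) (n : ℕ),
      Exec c (Regs.st ⟨inp, out, replicate n true, [], [], [], rj, rt⟩)
        (Regs.st ⟨inp, out, replicate n true, [], replicate (p.eval n) true, [], rj, rt⟩)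
        (P.eval n) := by
  induction p using Polynomial.recOnHorner with
  | M0 => exact ⟨skip, 1, fun inp out rj rt n => (Exec.skip _).cast rfl (by simp) (by simp)⟩
  | MC p a _ _ ih =>
    obtain ⟨c, P, h⟩ := ih
    refine ⟨seq c (pushAll .i (replicate a true)), P + .C (a + 1), fun inp out rj rt n => ?_⟩
    exact ((h inp out rj rt n).seq (exec_pushAll _ _ _)).cast rfl
      (by simp [Nat.add_comm]) (by simp)
  | MX p _ ih =>
    obtain ⟨c, P, h⟩ := ih
    refine ⟨seq c mulStep, P + (p * (5 * .X + 3) + 1 + (p * .X * 2 + 1)),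
      fun inp out rj rt n => ?_⟩
    exact ((h inp out rj rt n).seq (exec_mulStep inp out rj rt _ n)).cast rfl
      (by simp) (by simp)

/-- The length of the input is computed in unary. -/
def readInput : Cmd Reg :=
  seq (loop .inp (seq (push .t true) (push .a true)) (seq (push .t false) (push .a true)))
    (move .t .inp)

theorem exec_readInput (x : List Bool) :
    Exec readInput (Regs.st { inp := x }) (Regs.st { inp := x, a := replicate x.length true })
      (x.length * 5 + 2) := by
  have h1 := Exec.loop_list (k := .inp) (c := seq (push Reg.t true) (push .a true))
    (d := seq (push Reg.t false) (push .a true)) (l := x) (T := 2)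
    (fun u r => Regs.st { inp := r, t := u, a := replicate u.length true })
    (fun _ _ => rfl) fun u b r _ => by
      rw [Regs.update_inp]
      have := ((Exec.push Reg.t b (Regs.st
        { inp := r, t := u, a := replicate u.length true })).seq (.push .a true _)).cast
        rfl (s₀' := Regs.st { inp := r, t := b :: u, a := replicate (b :: u).length true })
        (by simp [List.replicate_succ]) le_rfl
      cases b <;> exact this
  exact (h1.seq (exec_move (by decide) _)).cast rfl (by simp) (by simp; omega)

/-- For unary numbers `m` and `n`, the stacks `a` and `c` become copies of `i`, which is cleared. -/
theorem exec_copy (inp out rj rt : List Bool) (m : ℕ) :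
    Exec (loop .i (seq (push .a true) (push .c true)) skip)
      (Regs.st ⟨inp, out, [], [], replicate m true, [], rj, rt⟩)
      (Regs.st ⟨inp, out, replicate m true, replicate m true, [], [], rj, rt⟩) (m * 3 + 1) :=
  Exec.loop_unary (n := m) (T := 2) (fun u v => Regs.st
    ⟨inp, out, replicate u true, replicate u true, replicate v true, [], rj, rt⟩)
    (fun _ _ => rfl) fun u v _ => by
      rw [Regs.update_i]
      exact ((Exec.push _ _ _).seq (.push _ _ _)).cast rfl (by simp [List.replicate_succ]) le_rfl

/-- A main loop: for each bit `b` of the stack `a`, something that depends on `b` and on the number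
`i` of earlier iterations is printed. The counter `i` goes on from earlier main loops. -/
theorem exists_mainLoop {g : Bool → ℕ → List Bool} (h : ∀ b, EmitsAt (g b)) :
    ∃ (c : Cmd Reg) (P : Polynomial ℕ), ∀ (G : ℕ → List Bool) (l inp out rc : List Bool) (i : ℕ),
      (∀ k b, l[k]? = some b → G (i + k) = g b (i + k)) →
      Exec c (Regs.st ⟨inp, catBelow G i ++ out, l, rc, replicate i true, [], [], []⟩)
        (Regs.st ⟨inp, catBelow G (i + l.length) ++ out, [], rc, replicate (i + l.length) true,
          [], [], []⟩) (P.eval (i + l.length)) := by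
  obtain ⟨c, P, hc⟩ := h true
  obtain ⟨c', P', hc'⟩ := h false
  refine ⟨loop .a (seq c (push .i true)) (seq c' (push .i true)), .X * (P + P' + 2) + 1,
    fun G l inp out rc i hG => ?_⟩
  refine (Exec.loop_list (l := l) (T := P.eval (i + l.length) + P'.eval (i + l.length) + 1)
    (fun u r => Regs.st ⟨inp, catBelow G (i + u.length) ++ out, r, rc,
      replicate (i + u.length) true, [], [], []⟩) (fun _ _ => rfl) fun u b r hl => ?_).cast
    (by simp) (by simp) (by simp; nlinarith)
  rw [Regs.update_a]
  have hGb := hG u.length b (by simp [hl])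
  have hle : i + u.length ≤ i + l.length := by simp [hl]
  have h1 := evalNat_mono P hle
  have h2 := evalNat_mono P' hle
  cases b
  · exact ((hc' _ _ rfl rfl rfl rfl).seq (.push _ _ _)).cast rfl
      (by simp [← Nat.add_assoc, List.replicate_succ, catBelow, hGb]) (by omega)
  · exact ((hc _ _ rfl rfl rfl rfl).seq (.push _ _ _)).cast rfl
      (by simp [← Nat.add_assoc, List.replicate_succ, catBelow, hGb]) (by omega)

/-- A function is computable in polynomial time if its value at `x` consists of
* a part that depends on the number `N = 2 * p |x| + |x|`,
* parts for each `i < N`, of which the first `p |x|` and the last `p |x|` only depend on `i`, and the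
  ones in between also on a bit of `x`,
* a part that depends on the number `p |x|`,
where all these parts can be printed. -/
theorem computableInPolyTime_of_emitsAt (p : Polynomial ℕ) {gN gS gB : ℕ → List Bool}
    {g : Bool → ℕ → List Bool} (hN : EmitsAt gN) (hS : EmitsAt gS) (hB : EmitsAt gB)
    (hg : ∀ b, EmitsAt (g b)) (G : List Bool → ℕ → List Bool)
    (h1 : ∀ x, ∀ k < p.eval x.length, G x k = gB k)
    (h2 : ∀ x k b, x[k]? = some b → G x (p.eval x.length + k) = g b (p.eval x.length + k))
    (h3 : ∀ x, ∀ k < p.eval x.length,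
      G x (p.eval x.length + x.length + k) = gB (p.eval x.length + x.length + k)) :
    Nonempty (Turing.TM2ComputableInPolyTime id id fun x =>
      gN (p.eval x.length + x.length + p.eval x.length) ++
        (catBelow (G x) (p.eval x.length + x.length + p.eval x.length) ++
          gS (p.eval x.length))) := by
  obtain ⟨cp, Pp, hp⟩ := exists_evalPolynomial p
  obtain ⟨cN, PN, hN⟩ := hN
  obtain ⟨cS, PS, hS⟩ := hS
  obtain ⟨cB, PB, hB⟩ := exists_mainLoop (g := fun _ => gB) fun _ => hB
  obtain ⟨cg, Pg, hg⟩ := exists_mainLoop hg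
  -- The three main loops run through the cells to the left of the input, those of the input, and
  -- those to the right of it. As output is prepended, the header comes last. The input is moved twice
  -- so as not to be reversed.
  refine computableInPolyTime (seq readInput (seq cp (seq (clear .a) (seq cS (seq
    (loop .i (seq (push .a true) (push .c true)) skip) (seq cB (seq (move .inp .t) (seq (move .t .a)
    (seq cg (seq (move .c .a) (seq cB (seq cN (clear .i))))))))))))) .inp .out _
    ((.X * 5 + 2) + (Pp + ((.X * 2 + 1) + (PS.comp p + ((p * 3 + 1) + (PB.comp p + ((.X * 2 + 1) +
    ((.X * 2 + 1) + (Pg.comp (p + .X) + ((p * 2 + 1) + (PB.comp (p + .X + p) +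
    (PN.comp (p + .X + p) + ((p + .X + p) * 2 + 1))))))))))))) fun x => ?_
  set n := x.length with hn
  set S := p.eval n with hS'
  have e1 := exec_readInput x
  have e2 := hp x [] [] [] n
  have e3 := exec_clear .a (Regs.st ⟨x, [], replicate n true, [], replicate S true, [], [], []⟩)
  have e4 := hS ⟨x, [], [], [], replicate S true, [], [], []⟩ S rfl rfl rfl rfl
  have e5 := exec_copy x (gS S ++ []) [] [] S
  have e6 := hB (G x) (replicate S true) x (gS S ++ []) (replicate S true) 0 (by
    intro k b hk
    have : k < S := by
      by_contra h
      simp [List.getElem?_eq_none (l := replicate S true) (i := k) (by simpa using h)] at hk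
    simpa using h1 x k this)
  simp only [List.length_replicate, Nat.zero_add] at e6
  have e7 := exec_move (k := Reg.inp) (k' := .t) (by decide) (Regs.st ⟨x, catBelow (G x) S ++
    (gS S ++ []), [], replicate S true, replicate S true, [], [], []⟩)
  have e8 := exec_move (k := Reg.t) (k' := .a) (by decide) (Regs.st ⟨[], catBelow (G x) S ++
    (gS S ++ []), [], replicate S true, replicate S true, [], [], x.reverse⟩)
  have e9 := hg (G x) x [] (gS S ++ []) (replicate S true) S (h2 x)
  have e10 := exec_move (k := Reg.c) (k' := .a) (by decide) (Regs.st ⟨[], catBelow (G x) (S + n) ++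
    (gS S ++ []), [], replicate S true, replicate (S + n) true, [], [], []⟩)
  have e11 := hB (G x) (replicate S true) [] (gS S ++ []) [] (S + n) (by
    intro k b hk
    have : k < S := by
      by_contra h
      simp [List.getElem?_eq_none (l := replicate S true) (i := k) (by simpa using h)] at hk
    exact h3 x k this)
  simp only [List.length_replicate] at e11
  have e12 := hN ⟨[], catBelow (G x) (S + n + S) ++ (gS S ++ []), [], [],
    replicate (S + n + S) true, [], [], []⟩ _ rfl rfl rfl rfl
  have e13 := exec_clear .i (Regs.st ⟨[], gN (S + n + S) ++ (catBelow (G x) (S + n + S) ++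
    (gS S ++ [])), [], [], replicate (S + n + S) true, [], [], []⟩)
  have f1 : Function.update (fun _ => []) Reg.inp x = Regs.st { inp := x } := by
    funext k; cases k <;> rfl
  have f2 : ∀ y, Function.update (fun _ => []) Reg.out y = Regs.st { out := y } := by
    intro y; funext k; cases k <;> rfl
  rw [f1, f2]
  refine (e1.seq (e2.seq (e3.seq ((e4.cast (by simp) rfl le_rfl).seq (e5.seq ((e6.cast ?_ rfl
    le_rfl).seq (e7.seq ((e8.cast ?_ rfl le_rfl).seq ((e9.cast ?_ rfl le_rfl).seq (e10.seq
    ((e11.cast ?_ rfl le_rfl).seq (e12.seq e13)))))))))))).cast rfl ?_ ?_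
  · simp [catBelow]
  · simp
  · simp
  · simp
  · simp
  · simp [← hS', ← hn]

end Cmd

/-! ### Words that are far from a language -/

section Distance

variable {α : Type*}

theorem IsEditPath.split {p : List (EditOp α)} {x₁ x₂ y : List α} (h : IsEditPath p (x₁ ++ x₂) y) :
    ∃ p₁ p₂ y₁ y₂, p = p₁ ++ p₂ ∧ y = y₁ ++ y₂ ∧ IsEditPath p₁ x₁ y₁ ∧ IsEditPath p₂ x₂ y₂ := by
  obtain ⟨h1, rfl⟩ := h
  obtain ⟨l₁, l₂, hl, rfl, rfl⟩ := List.filterMap_eq_append_iff.1 h1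
  obtain ⟨p₁, p₂, rfl, rfl, rfl⟩ := List.map_eq_append_iff.1 hl
  exact ⟨p₁, p₂, _, _, rfl, by simp [List.reduceOption_append], ⟨rfl, rfl⟩, ⟨rfl, rfl⟩⟩

theorem IsEditPath.eq_of_pathWeight_eq_zero {p : List (EditOp α)} {x y : List α}
    (h : IsEditPath p x y) (hp : pathWeight p = 0) : x = y := by
  obtain ⟨rfl, rfl⟩ := h
  congr 1
  refine List.map_congr_left fun e he => ?_
  have := List.sum_eq_zero_iff.1 hp _ (List.mem_map_of_mem he)
  by_contra hne
  simp [EditOp.weight, hne] at this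

/-- Each operation of an edit path consumes a letter of the source or has weight `1`. -/
theorem IsEditPath.length_le_add_pathWeight {p : List (EditOp α)} {x y : List α}
    (h : IsEditPath p x y) : p.length ≤ x.length + pathWeight p := by
  obtain ⟨rfl, -⟩ := h
  induction p with
  | nil => simp
  | cons e p ih =>
    obtain ⟨⟨a, b⟩, he⟩ := e
    cases a with
    | none =>
      have hb : none ≠ b := fun hb => he (by rw [hb])
      simp [pathWeight, EditOp.weight, hb] at ih ⊢
      omega
    | some a =>
      simp [pathWeight] at ih ⊢
      omega

theorem pathWeight_append (p q : List (EditOp α)) :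
    pathWeight (p ++ q) = pathWeight p + pathWeight q := by
  simp [pathWeight]

/-- An edit path from a power of `v` to a word without factor `v` has to spend weight on each of
the copies of `v`. -/
theorem IsEditPath.length_le_mul_pathWeight {v : List α} (n : ℕ) {p : List (EditOp α)}
    {y : List α} (h : IsEditPath p (List.replicate n v).flatten y) (hy : ¬ v <:+: y) :
    p.length ≤ (v.length + 1) * pathWeight p := by
  induction n generalizing p y with
  | zero =>
    have := h.length_le_add_pathWeight
    simp only [List.replicate_zero, List.flatten_nil, List.length_nil] at this
    nlinarith
  | succ n ih =>
    rw [List.replicate_succ, List.flatten_cons] at h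
    obtain ⟨p₁, p₂, y₁, y₂, rfl, rfl, h₁, h₂⟩ := h.split
    have e₂ := ih h₂ fun hv => hy (hv.trans (List.suffix_append _ _).isInfix)
    have e₁ := h₁.length_le_add_pathWeight
    have hp : 1 ≤ pathWeight p₁ := by
      by_contra hp
      have := h₁.eq_of_pathWeight_eq_zero (by omega)
      exact hy (this ▸ (List.prefix_append _ _).isInfix)
    rw [pathWeight_append, List.length_append]
    nlinarith

theorem inv_le_ned {v : List α} (hv : v ≠ []) {n : ℕ} (hn : 0 < n) {y : List α}
    (hy : ¬ v <:+: y) :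
    ((v.length : ℝ≥0) + 1)⁻¹ ≤ ned (List.replicate n v).flatten y := by
  obtain ⟨p, hp, hpc⟩ := ned_attained (List.replicate n v).flatten y
  have hlen := hp.length_le_mul_pathWeight n hy
  have hpos : 0 < p.length := by
    rcases p with _ | ⟨e, p⟩
    · obtain ⟨m, rfl⟩ := Nat.exists_eq_succ_of_ne_zero hn.ne'
      have := hp.1
      simp [List.replicate_succ, hv] at this
    · simp
  have hpos' : (0 : ℝ≥0) < p.length := by exact_mod_cast hpos
  rw [← hpc, pathCost, le_div_iff₀ hpos', inv_mul_le_iff₀ (by positivity)]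
  exact_mod_cast hlen

/-- If some nonempty word is no factor of any word of `Y`, then its powers stay away from `Y`. -/
theorem directedAHned_univ_pos {v : List α} (hv : v ≠ []) {Y : Set (List α)}
    (hY : ∀ y ∈ Y, ¬ v <:+: y) : 0 < directedAHned Set.univ Y := by
  have hpos : (0 : ℝ≥0∞) < (((v.length : ℝ≥0) + 1)⁻¹ : ℝ≥0) := by
    rw [ENNReal.coe_pos]
    positivity
  refine hpos.trans_le (ge_of_tendsto' (tendsto_directedAH _ ned Set.univ Y) fun k => ?_)
  refine le_iSup_of_le (List.replicate (k + 1) v).flatten (le_iSup_of_le (Set.mem_univ _)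
    (le_iSup_of_le ?_ ?_))
  · have : k ≤ (List.replicate (k + 1) v).flatten.length := by
      have := List.length_pos_iff.2 hv
      simp
      nlinarith
    exact Nat.cast_le.2 this
  · refine le_min (le_iInf₂ fun y hy => ?_) (le_iSup_of_le (List.replicate (k + 1) v).flatten
      (le_iSup_of_le [] ?_))
    · exact ENNReal.coe_le_coe.2 (inv_le_ned hv k.succ_pos (hY y hy))
    · exact ENNReal.coe_le_coe.2 (inv_le_ned hv k.succ_pos (by simpa using hv))

theorem ned_self (x : List α) : ned x x = 0 := by
  have h : IsEditPath (x.map fun a => (⟨(some a, some a), by simp⟩ : EditOp α)) x x := by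
    constructor <;> induction x <;> simp_all
  refine le_antisymm ?_ zero_le
  have hw : pathWeight (x.map fun a => (⟨(some a, some a), by simp⟩ : EditOp α)) = 0 := by
    simp [pathWeight, EditOp.weight, Function.comp_def]
  exact csInf_le (OrderBot.bddBelow _) ⟨_, h, by simp [pathCost, hw]⟩

theorem directedAHned_univ_univ : directedAHned (Set.univ : Set (List α)) Set.univ = 0 := by
  refine le_antisymm (le_of_tendsto' (tendsto_directedAH _ ned Set.univ Set.univ) fun k => ?_)
    zero_le
  refine iSup_le fun x => iSup_le fun _ => iSup_le fun _ => (min_le_left _ _).trans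
    ((iInf₂_le x (Set.mem_univ _)).trans ?_)
  simp [ned_self]

end Distance

/-! ### The automaton that detects errors in computations -/

instance (M : TapeMachine) : Fintype M.Q := M.finQ
instance (M : TapeMachine) : Fintype M.A := M.finA

/-- `Run R s w s'`: the word `w` leads from `s` to `s'` in the transition system `R`. -/
inductive Run {S L : Type*} (R : S → L → S → Prop) : S → List L → S → Prop
  | nil (s) : Run R s [] s
  | cons {s a s' w s''} : R s a s' → Run R s' w s'' → Run R s (a :: w) s''

theorem Run.append {S L : Type*} {R : S → L → S → Prop} {s s' s'' : S} {v w : List L}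
    (h : Run R s v s') (h' : Run R s' w s'') : Run R s (v ++ w) s'' := by
  induction h with
  | nil s => exact h'
  | cons ha _ ih => exact .cons ha (ih h')

theorem Run.of_append {S L : Type*} {R : S → L → S → Prop} {s s'' : S} {v w : List L}
    (h : Run R s (v ++ w) s'') : ∃ s', Run R s v s' ∧ Run R s' w s'' := by
  induction v generalizing s with
  | nil => exact ⟨s, .nil s, h⟩
  | cons a v ih =>
    cases h with
    | cons ha h =>
      obtain ⟨s', h1, h2⟩ := ih h
      exact ⟨s', .cons ha h1, h2⟩

namespace TapeMachine

variable (M : TapeMachine)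

/-- Letters of the words that describe computations: `ev h q a` is a step in the state `q` with the
head, reading `a`, on the cell number `h`, and `sharp` separates computations. -/
inductive Letter : Type
  | sharp : Letter
  | ev (h : ℕ) (q : M.Q) (a : M.A) : Letter

/-- States of the automaton that detects errors:
* `error`: the current block, between two separators, has an error (or need not have one);
* `guess`: an error of the current block is still to come;
* `expect k q`: it is an error if the next letter is not a step in the state `q` on the cell number
  `k - 1`;
* `cell k b`: it is an error if the next step on the cell number `k - 1` does not read `b`.
The shift of the cell numbers makes room for a move to the left from the cell number `0`. -/
inductive State : Type
  | error : State
  | guess : State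
  | expect (k : ℕ) (q : M.Q) : State
  | cell (k : ℕ) (b : M.A) : State

variable {M}

/-- The number, shifted by one, of the cell reached from the cell number `h`. -/
def target (h : ℕ) : Turing.Dir → ℕ
  | .left => h
  | .right => h + 2

open Letter State

/-- The transitions of the automaton that detects errors. There are `N` cells, the `h`-th one
initially contains `τ h`, and the head starts on the cell number `S`. That an accepting computation
halts counts as an error; hence the computations without errors are the rejecting ones. -/
inductive Step (S N : ℕ) (τ : ℕ → M.A) : M.State → M.Letter → M.State → Prop
  | error_ev {h} (hN : h < N) (q a) : Step S N τ error (ev h q a) error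
  | start_guess : Step S N τ error sharp guess
  | start_expect : Step S N τ error sharp (expect (S + 1) M.start)
  | start_cell {h} (hN : h < N) : Step S N τ error sharp (cell (h + 1) (τ h))
  | guess_guess {h} (hN : h < N) (q a) : Step S N τ guess (ev h q a) guess
  | guess_expect {h q a q' b dir} (hN : h < N) (hδ : M.δ q a = some (q', b, dir)) :
      Step S N τ guess (ev h q a) (expect (target h dir) q')
  | guess_cell {h q a q' b dir} (hN : h < N) (hδ : M.δ q a = some (q', b, dir)) :
      Step S N τ guess (ev h q a) (cell (h + 1) b)
  | guess_error {h q a} (hN : h < N) (hδ : M.δ q a = none) (hq : q ∈ M.accept) :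
      Step S N τ guess (ev h q a) error
  | expect_sharp {h} (hN : h < N) (q) : Step S N τ (expect (h + 1) q) sharp error
  | expect_head {h h'} (hN : h < N) (hN' : h' < N) (hh : h ≠ h') (q q' a) :
      Step S N τ (expect (h + 1) q) (ev h' q' a) error
  | expect_state {h q q'} (hN : h < N) (hq : q ≠ q') (a) :
      Step S N τ (expect (h + 1) q) (ev h q' a) error
  | cell_skip {h h'} (hN : h < N) (hN' : h' < N) (hh : h ≠ h') (b q a) :
      Step S N τ (cell (h + 1) b) (ev h' q a) (cell (h + 1) b)
  | cell_error {h b a} (hN : h < N) (hb : b ≠ a) (q) :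
      Step S N τ (cell (h + 1) b) (ev h q a) error

/-- The letter only mentions existing cells. -/
def Letter.Valid (N : ℕ) : M.Letter → Prop
  | sharp => True
  | ev h _ _ => h < N

/-- The state only mentions existing cells, or those next to them. -/
def State.Valid (N : ℕ) : M.State → Prop
  | expect k _ => k < N + 2
  | cell k _ => k < N + 2
  | _ => True

theorem Step.valid {S N : ℕ} {τ : ℕ → M.A} (hS : S < N) {s s' : M.State} {l : M.Letter}
    (h : Step S N τ s l s') : s.Valid N ∧ l.Valid N ∧ s'.Valid N := by
  cases h <;> simp only [State.Valid, Letter.Valid] <;>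
    first
    | (refine ⟨?_, ?_, ?_⟩ <;> first | trivial | omega)
    | (rename_i dir _ _; cases dir <;> simp only [target, true_and] <;> omega)

section Trace

variable {x : List Bool} {S N : ℕ} {τ : ℕ → M.A}

/-- The letter describing the step to be done in a configuration; the cell `z` of the machine has
the number `z + S`. -/
def letterOf (S : ℕ) (c : M.Cfg) : M.Letter :=
  ev (c.head + S).toNat c.state (c.tape c.head)

/-- The states in which the automaton may be, not having found an error, when the computation has
reached the configuration `c`. -/
def Fits (S N : ℕ) (c : M.Cfg) : M.State → Prop
  | error => False
  | guess => True
  | expect k q => (k : ℤ) = c.head + S + 1 ∧ q = c.state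
  | cell k b => ∃ h < N, k = h + 1 ∧ b = c.tape (h - S)

theorem step_eq_some {c c' : M.Cfg} (h : M.step c = some c') :
    ∃ q b dir, M.δ c.state (c.tape c.head) = some (q, b, dir) ∧ c'.state = q ∧
      c'.tape = Function.update c.tape c.head b ∧
      ∀ k : ℕ, (k : ℤ) = c.head + S → (target k dir : ℤ) = c'.head + S + 1 := by
  simp only [step, Option.map_eq_some_iff] at h
  obtain ⟨⟨q, b, dir⟩, h1, rfl⟩ := h
  refine ⟨q, b, dir, h1, rfl, rfl, fun k hk => ?_⟩
  cases dir <;> simp [target] <;> omega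

theorem step_eq_none {c : M.Cfg} (h : M.step c = none) : M.δ c.state (c.tape c.head) = none := by
  simpa [step] using h

theorem step_error_sharp (hτ : ∀ h, τ h = (M.init x).tape (h - S)) {s : M.State} :
    Step S N τ error sharp s ↔ Fits S N (M.init x) s := by
  constructor
  · intro h
    cases h with
    | start_guess => trivial
    | start_expect => exact ⟨by simp [init], rfl⟩
    | start_cell hN => exact ⟨_, hN, rfl, hτ _⟩
  · intro h
    cases s with
    | error => exact h.elim
    | guess => exact .start_guess
    | expect k q =>
      obtain ⟨h1, rfl⟩ := h
      obtain rfl : k = S + 1 := by simp only [init] at h1; omega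
      exact .start_expect
    | cell k b =>
      obtain ⟨h, hN, rfl, rfl⟩ := h
      rw [← hτ]
      exact .start_cell hN

theorem run_error {w : List M.Letter} (hw : ∀ l ∈ w, l.Valid N ∧ l ≠ sharp) :
    Run (Step S N τ) error w error := by
  induction w with
  | nil => exact .nil _
  | cons l w ih =>
    refine .cons ?_ (ih fun l hl => hw l (by simp [hl]))
    cases l with
    | sharp => exact absurd rfl (hw sharp (by simp)).2
    | ev h q a => exact .error_ev (hw (ev h q a) (by simp)).1 q a

theorem run_guess {w : List M.Letter} (hw : ∀ l ∈ w, l.Valid N ∧ l ≠ sharp) :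
    Run (Step S N τ) guess w guess := by
  induction w with
  | nil => exact .nil _
  | cons l w ih =>
    refine .cons ?_ (ih fun l hl => hw l (by simp [hl]))
    cases l with
    | sharp => exact absurd rfl (hw sharp (by simp)).2
    | ev h q a => exact .guess_guess (hw (ev h q a) (by simp)).1 q a

/-- If no rejecting halting configuration is reachable, then every block has an error: this is
found within the block, or there is a step missing at its end. -/
theorem exists_run_error
    (hS : ∀ c, StateTransition.Reaches M.step (M.init x) c → c.head.natAbs < S) (hN : S + S ≤ N)
    (hx : ∀ c, StateTransition.Reaches M.step (M.init x) c → M.step c = none → c.state ∈ M.accept)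
    {w : List M.Letter} (hw : ∀ l ∈ w, l.Valid N ∧ l ≠ sharp) {c : M.Cfg}
    (hc : StateTransition.Reaches M.step (M.init x) c) :
    ∃ s, Fits S N c s ∧ (Run (Step S N τ) s w error ∨
      ∃ h < N, ∃ q, Run (Step S N τ) s w (expect (h + 1) q)) := by
  induction w generalizing c with
  | nil =>
    have := hS c hc
    exact ⟨expect ((c.head + S).toNat + 1) c.state, ⟨by omega, rfl⟩,
      .inr ⟨_, by omega, _, .nil _⟩⟩
  | cons l w ih =>
    have hcS := hS c hc
    have hw' : ∀ l ∈ w, l.Valid N ∧ l ≠ sharp := fun l hl => hw l (by simp [hl])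
    obtain ⟨k, hk⟩ : ∃ k : ℕ, (k : ℤ) = c.head + S := ⟨(c.head + S).toNat, by omega⟩
    have hkN : k < N := by omega
    rcases l with _ | ⟨h, q, a⟩
    · exact absurd rfl (hw sharp (by simp)).2
    have hh : h < N := (hw (ev h q a) (by simp)).1
    by_cases h1 : k = h
    swap
    · exact ⟨expect (k + 1) c.state, ⟨by omega, rfl⟩,
        .inl (.cons (.expect_head hkN hh h1 _ _ _) (run_error hw'))⟩
    subst h1
    by_cases h2 : c.state = q
    swap
    · exact ⟨expect (k + 1) c.state, ⟨by omega, rfl⟩,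
        .inl (.cons (.expect_state hkN h2 _) (run_error hw'))⟩
    subst h2
    have hks : ((k : ℤ) - S) = c.head := by omega
    by_cases h3 : c.tape c.head = a
    swap
    · exact ⟨cell (k + 1) (c.tape c.head), ⟨k, hkN, rfl, by rw [hks]⟩,
        .inl (.cons (.cell_error hkN h3 _) (run_error hw'))⟩
    subst h3
    rcases hstep : M.step c with _ | c'
    · exact ⟨guess, trivial,
        .inl (.cons (.guess_error hkN (step_eq_none hstep) (hx c hc hstep)) (run_error hw'))⟩
    obtain ⟨q, b, dir, hδ, hq, htape, htar⟩ := step_eq_some (S := S) hstep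
    obtain ⟨s', hs', hrun⟩ := ih hw' (hc.tail hstep)
    obtain ⟨s, hs, hss'⟩ : ∃ s, Fits S N c s ∧
        Step S N τ s (ev k c.state (c.tape c.head)) s' := by
      cases s' with
      | error => exact hs'.elim
      | guess => exact ⟨guess, trivial, .guess_guess hkN _ _⟩
      | expect k' q' =>
        obtain ⟨h4, rfl⟩ := hs'
        obtain rfl : k' = target k dir := by
          have := htar k hk
          omega
        exact ⟨guess, trivial, hq ▸ .guess_expect hkN hδ⟩
      | cell k' b' =>
        obtain ⟨h, hN, rfl, rfl⟩ := hs'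
        by_cases hkh : h = k
        · subst hkh
          rw [htape, hks, Function.update_self]
          exact ⟨guess, trivial, .guess_cell hkN hδ⟩
        · refine ⟨cell (h + 1) (c.tape (h - S)), ⟨h, hN, rfl, rfl⟩, ?_⟩
          rw [htape, Function.update_of_ne (by omega)]
          exact .cell_skip hN hkN hkh _ _ _
    refine ⟨s, hs, hrun.imp (.cons hss') ?_⟩
    rintro ⟨h, hN, q, hr⟩
    exact ⟨h, hN, q, .cons hss' hr⟩

/-- If no rejecting halting configuration is reachable, then the automaton accepts everything. -/
theorem exists_run_of_accepts
    (hS : ∀ c, StateTransition.Reaches M.step (M.init x) c → c.head.natAbs < S) (hN : S + S ≤ N)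
    (hτ : ∀ h, τ h = (M.init x).tape (h - S))
    (hx : ∀ c, StateTransition.Reaches M.step (M.init x) c → M.step c = none → c.state ∈ M.accept)
    (n : ℕ) (u : List M.Letter) (hu : ∀ l ∈ u, l.Valid N) (hn : u.length ≤ n) :
    ∃ s, (s = error ∨ s = guess) ∧ Run (Step S N τ) error u s := by
  have split : ∀ u : List M.Letter, (∀ l ∈ u, l ≠ sharp) ∨
      ∃ v u', u = v ++ sharp :: u' ∧ ∀ l ∈ v, l ≠ sharp := by
    intro u
    by_cases h : sharp ∈ u
    · obtain ⟨v, u', rfl, hv⟩ := List.eq_append_cons_of_mem h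
      exact .inr ⟨v, u', rfl, fun l hl e => hv (e ▸ hl)⟩
    · exact .inl fun l hl e => h (e ▸ hl)
  induction n generalizing u with
  | zero =>
    obtain rfl : u = [] := List.length_eq_zero_iff.1 (by omega)
    exact ⟨error, .inl rfl, .nil _⟩
  | succ n ih =>
    rcases split u with h | ⟨v, u', rfl, hv⟩
    · exact ⟨error, .inl rfl, run_error fun l hl => ⟨hu l hl, h l hl⟩⟩
    have hv' : Run (Step S N τ) error v error :=
      run_error fun l hl => ⟨hu l (by simp [hl]), hv l hl⟩
    rcases split u' with h | ⟨w, u'', rfl, hw⟩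
    · exact ⟨guess, .inr rfl, hv'.append (.cons .start_guess
        (run_guess fun l hl => ⟨hu l (by simp [hl]), h l hl⟩))⟩
    obtain ⟨s, hs, h | ⟨h, hh, q, hr⟩⟩ := exists_run_error (τ := τ) hS hN hx (w := w)
      (fun l hl => ⟨hu l (by simp [hl]), hw l hl⟩) .refl
    · obtain ⟨s', hs', h'⟩ := ih (sharp :: u'')
        (fun l hl => hu l (by simp at hl ⊢; tauto)) (by simp at hn ⊢; omega)
      exact ⟨s', hs', hv'.append (.cons ((step_error_sharp hτ).2 hs) (h.append h'))⟩
    · obtain ⟨s', hs', h'⟩ := ih u'' (fun l hl => hu l (by simp [hl])) (by simp at hn ⊢; omega)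
      exact ⟨s', hs', hv'.append (.cons ((step_error_sharp hτ).2 hs)
        (hr.append (.cons (.expect_sharp hh q) h')))⟩

/-- In the description of a computation, no error is found. -/
theorem Fits.step {c c' : M.Cfg} (hc : c.head.natAbs < S) (h : M.step c = some c')
    {s s' : M.State} (hs : Fits S N c s) (hss' : Step S N τ s (letterOf S c) s') :
    Fits S N c' s' := by
  obtain ⟨q, b, dir, hδ, hq, htape, htar⟩ := step_eq_some (S := S) h
  obtain ⟨k, hk⟩ : ∃ k : ℕ, (k : ℤ) = c.head + S := ⟨(c.head + S).toNat, by omega⟩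
  have hks : ((k : ℤ) - S) = c.head := by omega
  have hl : letterOf S c = ev k c.state (c.tape c.head) := by
    rw [letterOf, ← hk]
    rfl
  rw [hl] at hss'
  cases hss' with
  | error_ev => exact hs.elim
  | guess_guess => trivial
  | guess_expect hN hδ' =>
    rw [hδ] at hδ'
    cases hδ'
    exact ⟨htar k hk, hq.symm⟩
  | guess_cell hN hδ' =>
    rw [hδ] at hδ'
    cases hδ'
    exact ⟨k, hN, rfl, by rw [htape, hks, Function.update_self]⟩
  | guess_error hN hδ' => simp [hδ] at hδ'
  | expect_head hN hN' hh =>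
    have := hs.1
    omega
  | expect_state hN hq' => exact absurd hs.2 hq'
  | cell_skip hN hN' hh =>
    obtain ⟨h', -, h1, h2⟩ := hs
    obtain rfl := Nat.succ_injective h1
    exact ⟨_, hN, rfl, by rw [htape, Function.update_of_ne (by omega), h2]⟩
  | cell_error hN hb =>
    obtain ⟨h', -, h1, h2⟩ := hs
    obtain rfl := Nat.succ_injective h1
    rw [hks] at h2
    exact absurd h2 hb

/-- A rejecting computation yields a block without errors. -/
theorem exists_block {c cf : M.Cfg} (h : StateTransition.Reaches M.step c cf)
    (hS : ∀ c', StateTransition.Reaches M.step c c' → c'.head.natAbs < S) (hN : S + S ≤ N)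
    (hcf : M.step cf = none) (hrej : cf.state ∉ M.accept) :
    ∃ w : List M.Letter, (∀ l ∈ w, l.Valid N ∧ l ≠ sharp) ∧
      ∀ s s', Fits S N c s → Run (Step S N τ) s w s' → ∀ s'', ¬ Step S N τ s' sharp s'' := by
  have hl : ∀ c : M.Cfg, c.head.natAbs < S →
      (letterOf S c).Valid N ∧ letterOf S c ≠ sharp := by
    intro c hc
    refine ⟨?_, by simp [letterOf]⟩
    simp only [letterOf, Letter.Valid]
    omega
  induction h using Relation.ReflTransGen.head_induction_on with
  | refl =>
    have hcS := hS _ .refl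
    refine ⟨[letterOf S cf], by simpa using hl cf hcS, fun s s' hs hr s'' hs'' => ?_⟩
    obtain ⟨k, hk⟩ : ∃ k : ℕ, (k : ℤ) = cf.head + S := ⟨(cf.head + S).toNat, by omega⟩
    have hks : ((k : ℤ) - S) = cf.head := by omega
    have hl : letterOf S cf = ev k cf.state (cf.tape cf.head) := by
      rw [letterOf, ← hk]
      rfl
    rw [hl] at hr
    have hδ := step_eq_none hcf
    rcases hr with _ | ⟨h1, ⟨⟩⟩
    cases h1 with
    | error_ev => exact hs
    | guess_guess => cases hs''
    | guess_expect hN hδ' => simp [hδ] at hδ'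
    | guess_cell => cases hs''
    | guess_error hN hδ' hacc => exact hrej hacc
    | expect_head hN hN' hh =>
      have := hs.1
      omega
    | expect_state hN hq' => exact hq' hs.2
    | cell_skip => cases hs''
    | cell_error hN hb =>
      obtain ⟨h', -, h1, h2⟩ := hs
      obtain rfl := Nat.succ_injective h1
      rw [hks] at h2
      exact hb h2
  | @head c c' hcc' _ ih =>
    obtain ⟨w, hw, hrun⟩ := ih fun c'' h => hS c'' (h.head hcc')
    have hcS := hS _ .refl
    refine ⟨letterOf S c :: w, ?_, fun s s' hs hr => ?_⟩
    · simp only [List.mem_cons, forall_eq_or_imp]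
      exact ⟨hl c hcS, hw⟩
    · rcases hr with _ | ⟨h1, h2⟩
      exact hrun _ s' (hs.step hcS hcc' h1) h2

/-- If a rejecting halting configuration is reachable, then some word is no factor of any word that
is read by the automaton. -/
theorem exists_forbidden_factor {cf : M.Cfg}
    (hS : ∀ c, StateTransition.Reaches M.step (M.init x) c → c.head.natAbs < S) (hN : S + S ≤ N)
    (hτ : ∀ h, τ h = (M.init x).tape (h - S))
    (h : StateTransition.Reaches M.step (M.init x) cf)
    (hcf : M.step cf = none) (hrej : cf.state ∉ M.accept) :
    ∃ v : List M.Letter, v ≠ [] ∧ (∀ l ∈ v, l.Valid N) ∧ ∀ s s', ¬ Run (Step S N τ) s v s' := by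
  obtain ⟨w, hw, hrun⟩ := exists_block (τ := τ) h hS hN hcf hrej
  refine ⟨sharp :: (w ++ sharp :: (w ++ [sharp])), by simp, ?_, fun s s' hr => ?_⟩
  · intro l hl
    simp only [List.mem_cons, List.mem_append, List.not_mem_nil, or_false] at hl
    rcases hl with rfl | hl | rfl | hl | rfl
    exacts [trivial, (hw l hl).1, trivial, (hw l hl).1, trivial]
  have key : ∀ s s₁ u, Step S N τ error sharp s → ¬ Run (Step S N τ) s (w ++ sharp :: u) s₁ := by
    intro s s₁ u hs hr
    obtain ⟨s₂, h2, h3⟩ := hr.of_append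
    rcases h3 with _ | ⟨h3, -⟩
    exact hrun s s₂ ((step_error_sharp hτ).1 hs) h2 _ h3
  rcases hr with _ | ⟨h1, h2⟩
  -- After the first separator, the current block need not have an error if the previous one ended
  -- with a missing step; this is why the block occurs twice.
  by_cases hs : s = error
  · subst hs
    exact key _ _ _ h1 h2
  · obtain ⟨s₂, h3, h4⟩ := h2.of_append
    have e1 : ∀ s₁, Step S N τ s sharp s₁ → s₁ = error := by
      intro s₁ h
      cases h <;> first | rfl | exact absurd rfl hs
    have e2 : ∀ (w : List M.Letter) s₂, (∀ l ∈ w, l.Valid N ∧ l ≠ sharp) →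
        Run (Step S N τ) error w s₂ → s₂ = error := by
      intro w s₂ hw h
      induction w with
      | nil =>
        cases h
        rfl
      | cons l w ih =>
        rcases h with _ | ⟨h1, h2⟩
        cases h1 with
        | error_ev => exact ih (fun l hl => hw l (by simp [hl])) h2
        | _ => exact absurd rfl (hw sharp (by simp)).2
    obtain rfl := e1 _ h1
    obtain rfl := e2 w s₂ hw h3
    rcases h4 with _ | ⟨h4, h5⟩
    exact key _ _ _ h4 h5

end Trace

end TapeMachine

theorem mem_evalFrom_iff_run {α σ : Type*} (T : NFA α σ) (S : Set σ) (w : List α) (q : σ) :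
    q ∈ T.evalFrom S w ↔ ∃ s ∈ S, Run (fun p a q => q ∈ T.step p a) s w q := by
  induction w generalizing S with
  | nil =>
    constructor
    · exact fun h => ⟨q, h, .nil q⟩
    · rintro ⟨s, hs, h⟩
      cases h
      exact hs
  | cons a w ih =>
    rw [NFA.evalFrom_cons, ih]
    constructor
    · rintro ⟨s', hs', h⟩
      obtain ⟨s, hs, h'⟩ := NFA.mem_stepSet.1 hs'
      exact ⟨s, hs, .cons h' h⟩
    · rintro ⟨s, hs, h⟩
      rcases h with _ | ⟨h1, h2⟩
      exact ⟨_, NFA.mem_stepSet.2 ⟨s, hs, h1⟩, h2⟩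

namespace TapeMachine

open Letter State Cmd

variable {M : TapeMachine}

/-! ### The automaton as an instance of the decision problem -/

/-- The number of states of the automaton per cell. -/
noncomputable def stateWidth (M : TapeMachine) : ℕ := Fintype.card (M.Q ⊕ M.A)

/-- The number of letters per cell. -/
noncomputable def letterWidth (M : TapeMachine) : ℕ := Fintype.card (M.Q × M.A)

/-- The number of a state in the numbering used in the instance. -/
noncomputable def stateCode : M.State → ℕ
  | error => 0
  | guess => 1
  | expect k q => stateWidth M * k + (2 + Fintype.equivFin (M.Q ⊕ M.A) (.inl q))
  | cell k b => stateWidth M * k + (2 + Fintype.equivFin (M.Q ⊕ M.A) (.inr b))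

/-- The number of a letter in the numbering used in the instance. -/
noncomputable def letterCode : M.Letter → ℕ
  | sharp => 0
  | ev h q a => letterWidth M * h + (1 + Fintype.equivFin (M.Q × M.A) (q, a))

theorem mul_add_inj {m k k' i i' : ℕ} (hi : i < m) (hi' : i' < m)
    (h : m * k + i = m * k' + i') : k = k' ∧ i = i' := by
  have hm : 0 < m := by omega
  have h1 := congrArg (· / m) h
  have h2 := congrArg (· % m) h
  simp only [Nat.mul_add_div hm, Nat.mul_add_mod, Nat.div_eq_of_lt hi, Nat.div_eq_of_lt hi',
    Nat.mod_eq_of_lt hi, Nat.mod_eq_of_lt hi'] at h1 h2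
  exact ⟨by simpa using h1, h2⟩

theorem stateCode_injective : Function.Injective (stateCode (M := M)) := by
  have key : ∀ k k' (e e' : M.Q ⊕ M.A), stateWidth M * k + (2 + Fintype.equivFin (M.Q ⊕ M.A) e) =
      stateWidth M * k' + (2 + Fintype.equivFin (M.Q ⊕ M.A) e') → k = k' ∧ e = e' := by
    intro k k' e e' h
    obtain ⟨h1, h2⟩ := mul_add_inj (Fintype.equivFin (M.Q ⊕ M.A) e).2
      (Fintype.equivFin (M.Q ⊕ M.A) e').2 (k := k) (k' := k')
      (by simp only [stateWidth] at h; omega)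
    exact ⟨h1, (Fintype.equivFin (M.Q ⊕ M.A)).injective (Fin.ext h2)⟩
  intro s s' h
  cases s <;> cases s' <;> simp only [stateCode] at h <;>
    first
    | rfl
    | omega
    | (obtain ⟨rfl, he⟩ := key _ _ _ _ h
       cases he
       try rfl)

theorem letterCode_injective : Function.Injective (letterCode (M := M)) := by
  intro l l' h
  cases l <;> cases l' <;> simp only [letterCode] at h
  · rfl
  · omega
  · omega
  · rename_i k q a k' q' a'
    obtain ⟨rfl, h2⟩ := mul_add_inj (Fintype.equivFin (M.Q × M.A) (q, a)).2
      (Fintype.equivFin (M.Q × M.A) (q', a')).2 (k := k) (k' := k')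
      (by simp only [letterWidth] at h; omega)
    cases (Fintype.equivFin (M.Q × M.A)).injective (Fin.ext h2)
    rfl

theorem stateCode_lt {N : ℕ} {s : M.State} (h : s.Valid N) :
    stateCode s < stateWidth M * (N + 2) + 2 := by
  have key : ∀ k (e : M.Q ⊕ M.A), k < N + 2 →
      stateWidth M * k + (2 + Fintype.equivFin (M.Q ⊕ M.A) e) < stateWidth M * (N + 2) + 2 := by
    intro k e hk
    have h1 := Nat.mul_le_mul_left (stateWidth M) hk
    have h2 : (Fintype.equivFin (M.Q ⊕ M.A) e : ℕ) < stateWidth M := Fin.is_lt _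
    simp only [Nat.succ_eq_add_one, Nat.mul_add, mul_one] at h1 ⊢
    omega
  cases s with
  | error => simp [stateCode]
  | guess => simp [stateCode]
  | expect k q => exact key k _ h
  | cell k b => exact key k _ h

theorem letterCode_lt {N : ℕ} {l : M.Letter} (h : l.Valid N) :
    letterCode l < letterWidth M * N + 1 := by
  cases l with
  | sharp => simp [letterCode]
  | ev k q a =>
    have h1 := Nat.mul_le_mul_left (letterWidth M) (Nat.succ_le_of_lt h)
    have h2 : (Fintype.equivFin (M.Q × M.A) (q, a) : ℕ) < letterWidth M := Fin.is_lt _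
    simp only [Nat.succ_eq_add_one, Nat.mul_add_one] at h1
    simp only [letterCode]
    omega

theorem exists_letterCode_eq {N n : ℕ} (hn : n < letterWidth M * N + 1) :
    ∃ l : M.Letter, l.Valid N ∧ letterCode l = n := by
  rcases n with _ | n
  · exact ⟨sharp, trivial, rfl⟩
  have hpos : 0 < letterWidth M := by
    rcases Nat.eq_zero_or_pos (letterWidth M) with h | h
    · rw [h] at hn
      omega
    · exact h
  refine ⟨ev (n / letterWidth M)
    ((Fintype.equivFin (M.Q × M.A)).symm ⟨n % letterWidth M, Nat.mod_lt _ hpos⟩).1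
    ((Fintype.equivFin (M.Q × M.A)).symm ⟨n % letterWidth M, Nat.mod_lt _ hpos⟩).2, ?_, ?_⟩
  · exact Nat.div_lt_of_lt_mul (by omega)
  · simp only [letterCode, Prod.mk.eta, Equiv.apply_symm_apply]
    have := Nat.div_add_mod n (letterWidth M)
    omega

/-- Transitions of the automaton. -/
abbrev Tr (M : TapeMachine) : Type := M.State × M.Letter × M.State

open Classical in
/-- The transitions that only concern the cell number `i`. -/
noncomputable def cellTrans (i : ℕ) : List M.Tr :=
  (Finset.univ : Finset (M.Q × M.A)).toList.flatMap (fun (q, a) =>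
    [(error, ev i q a, error)] ++ [(guess, ev i q a, guess)] ++
    (match M.δ q a with
      | some (q', b, dir) =>
        [(guess, ev i q a, expect (target i dir) q')] ++ [(guess, ev i q a, cell (i + 1) b)]
      | none => if q ∈ M.accept then [(guess, ev i q a, error)] else [])) ++
  (Finset.univ : Finset M.Q).toList.flatMap (fun q => [(expect (i + 1) q, sharp, error)]) ++
  (Finset.univ : Finset (M.Q × M.Q × M.A)).toList.flatMap (fun (q, q', a) =>
    if q ≠ q' then [(expect (i + 1) q, ev i q' a, error)] else []) ++
  (Finset.univ : Finset (M.A × M.Q × M.A)).toList.flatMap (fun (b, q, a) =>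
    if b ≠ a then [(cell (i + 1) b, ev i q a, error)] else [])

/-- The transitions from states that concern the cell number `i`, by letters that concern another
cell, number `j`. -/
noncomputable def pairTrans (i j : ℕ) : List M.Tr :=
  (Finset.univ : Finset (M.Q × M.Q × M.A)).toList.flatMap (fun (q, q', a) =>
    [(expect (i + 1) q, ev j q' a, error)]) ++
  (Finset.univ : Finset (M.A × M.Q × M.A)).toList.flatMap (fun (b, q, a) =>
    [(cell (i + 1) b, ev j q a, cell (i + 1) b)])

/-- All the transitions that concern the cell number `i`, initially containing `b`, but no cell with
a larger number. -/
noncomputable def rowTrans (b : M.A) (i : ℕ) : List M.Tr :=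
  [(error, sharp, cell (i + 1) b)] ++ cellTrans i ++
    catBelow (fun j => pairTrans i j ++ pairTrans j i) i

/-- All the transitions of the automaton. -/
noncomputable def allTrans (S N : ℕ) (τ : ℕ → M.A) : List M.Tr :=
  catBelow (fun i => rowTrans (τ i) i) N ++
    ([(error, sharp, guess)] ++ [(error, sharp, expect (S + 1) M.start)])

theorem mem_catBelow {β : Type*} {g : ℕ → List β} {n : ℕ} {b : β} :
    b ∈ catBelow g n ↔ ∃ i < n, b ∈ g i := by
  induction n with
  | zero => simp [catBelow]
  | succ n ih =>
    simp only [catBelow, List.mem_append, ih, Nat.lt_succ_iff_lt_or_eq]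
    constructor
    · rintro (h | ⟨i, hi, h⟩)
      exacts [⟨n, .inr rfl, h⟩, ⟨i, .inl hi, h⟩]
    · rintro ⟨i, hi | rfl, h⟩
      exacts [.inr ⟨i, hi, h⟩, .inl h]

theorem flatMap_catBelow {β γ : Type*} (f : β → List γ) (g : ℕ → List β) (n : ℕ) :
    (catBelow g n).flatMap f = catBelow (fun i => (g i).flatMap f) n := by
  induction n with
  | zero => rfl
  | succ n ih => simp [catBelow, ih]

theorem mem_cellTrans {S N : ℕ} {τ : ℕ → M.A} {i : ℕ} (hi : i < N) {t : M.Tr}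
    (ht : t ∈ cellTrans i) : Step S N τ t.1 t.2.1 t.2.2 := by
  simp only [cellTrans, List.mem_append, List.mem_flatMap, Finset.mem_toList, Finset.mem_univ,
    true_and, Prod.exists, List.mem_singleton, or_assoc] at ht
  rcases ht with ⟨q, a, rfl | rfl | ht⟩ | ⟨q, rfl⟩ | ⟨q, q', a, ht⟩ | ⟨b, q, a, ht⟩
  · exact .error_ev hi _ _
  · exact .guess_guess hi _ _
  · rcases hδ : M.δ q a with _ | ⟨q', b, dir⟩
    · simp only [hδ] at ht
      split_ifs at ht with hq
      · obtain rfl := List.mem_singleton.1 ht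
        exact .guess_error hi hδ hq
      · simp at ht
    · simp only [hδ, List.mem_append, List.mem_singleton] at ht
      rcases ht with rfl | rfl
      exacts [.guess_expect hi hδ, .guess_cell hi hδ]
  · exact .expect_sharp hi _
  · split_ifs at ht with h
    · obtain rfl := List.mem_singleton.1 ht
      exact .expect_state hi h _
    · simp at ht
  · split_ifs at ht with h
    · obtain rfl := List.mem_singleton.1 ht
      exact .cell_error hi h _
    · simp at ht

theorem mem_pairTrans {S N : ℕ} {τ : ℕ → M.A} {i j : ℕ} (hi : i < N) (hj : j < N) (hij : i ≠ j)
    {t : M.Tr} (ht : t ∈ pairTrans i j) : Step S N τ t.1 t.2.1 t.2.2 := by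
  simp only [pairTrans, List.mem_append, List.mem_flatMap, Finset.mem_toList, Finset.mem_univ,
    true_and, Prod.exists, List.mem_singleton] at ht
  rcases ht with ⟨q, q', a, rfl⟩ | ⟨b, q, a, rfl⟩
  exacts [.expect_head hi hj hij _ _ _, .cell_skip hi hj hij _ _ _]

/-- The list of transitions is complete and correct. -/
theorem mem_allTrans {S N : ℕ} {τ : ℕ → M.A} {s s' : M.State} {l : M.Letter} :
    (s, l, s') ∈ allTrans S N τ ↔ Step S N τ s l s' := by
  constructor
  · intro h
    simp only [allTrans, rowTrans, List.mem_append, mem_catBelow, List.mem_singleton] at h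
    rcases h with ⟨i, hi, (h | h) | ⟨j, hj, h | h⟩⟩ | h | h
    · cases h
      exact .start_cell hi
    · exact mem_cellTrans hi h
    · exact mem_pairTrans hi (hj.trans hi) hj.ne' h
    · exact mem_pairTrans (hj.trans hi) hi hj.ne h
    · cases h
      exact .start_guess
    · cases h
      exact .start_expect
  · intro h
    have hcell : ∀ i < N, ∀ t ∈ cellTrans i, t ∈ allTrans S N τ := fun i hi t ht => by
      simp only [allTrans, rowTrans, List.mem_append, mem_catBelow]
      exact .inl ⟨i, hi, .inl (.inr ht)⟩
    have hpair : ∀ i < N, ∀ j < N, i ≠ j → ∀ t ∈ pairTrans i j, t ∈ allTrans S N τ :=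
        fun i hi j hj hij t ht => by
      simp only [allTrans, rowTrans, List.mem_append, mem_catBelow]
      rcases hij.lt_or_gt with h | h
      exacts [.inl ⟨j, hj, .inr ⟨i, h, .inr ht⟩⟩, .inl ⟨i, hi, .inr ⟨j, h, .inl ht⟩⟩]
    cases h with
    | start_guess => simp [allTrans]
    | start_expect => simp [allTrans]
    | start_cell hN =>
      simp only [allTrans, rowTrans, List.mem_append, mem_catBelow]
      exact .inl ⟨_, hN, .inl (.inl (by simp))⟩
    | expect_head hN hN' hh q q' a =>
      refine hpair _ hN _ hN' hh _ ?_
      simp [pairTrans]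
    | cell_skip hN hN' hh =>
      refine hpair _ hN _ hN' hh _ ?_
      simp [pairTrans]
    | error_ev hN q a =>
      refine hcell _ hN _ ?_
      simp only [cellTrans, List.mem_append, List.mem_flatMap, Finset.mem_toList]
      exact .inl (.inl (.inl ⟨(q, a), by simp⟩))
    | guess_guess hN q a =>
      refine hcell _ hN _ ?_
      simp only [cellTrans, List.mem_append, List.mem_flatMap, Finset.mem_toList]
      exact .inl (.inl (.inl ⟨(q, a), by simp⟩))
    | @guess_expect h q a q' b dir hN hδ =>
      refine hcell _ hN _ ?_
      simp only [cellTrans, List.mem_append, List.mem_flatMap, Finset.mem_toList]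
      exact .inl (.inl (.inl ⟨(q, a), by simp [hδ]⟩))
    | @guess_cell h q a q' b dir hN hδ =>
      refine hcell _ hN _ ?_
      simp only [cellTrans, List.mem_append, List.mem_flatMap, Finset.mem_toList]
      exact .inl (.inl (.inl ⟨(q, a), by simp [hδ]⟩))
    | @guess_error h q a hN hδ hq =>
      refine hcell _ hN _ ?_
      simp only [cellTrans, List.mem_append, List.mem_flatMap, Finset.mem_toList]
      exact .inl (.inl (.inl ⟨(q, a), by simp [hδ, hq]⟩))
    | expect_sharp hN q =>
      refine hcell _ hN _ ?_
      simp only [cellTrans, List.mem_append, List.mem_flatMap, Finset.mem_toList]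
      exact .inl (.inl (.inr ⟨q, by simp⟩))
    | @expect_state h q q' hN hq a =>
      refine hcell _ hN _ ?_
      simp only [cellTrans, List.mem_append, List.mem_flatMap, Finset.mem_toList]
      exact .inl (.inr ⟨(q, q', a), by simp [hq]⟩)
    | @cell_error h b a hN hb q =>
      refine hcell _ hN _ ?_
      simp only [cellTrans, List.mem_append, List.mem_flatMap, Finset.mem_toList]
      exact .inr ⟨(b, q, a), by simp [hb]⟩

/-- The automaton as an instance of the decision problem. It starts in the state `error` and accepts
in the states `error` and `guess`, so that the first and the last block need not have errors. The
remainders do not change the numbers, all of them being in range. -/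
noncomputable def errorNFA (S N : ℕ) (τ : ℕ → M.A) : FiniteNFA where
  numLetters := letterWidth M * N + 1
  numStates := stateWidth M * (N + 2) + 2
  start := [⟨0, by omega⟩]
  accept := [⟨0, by omega⟩, ⟨1, by omega⟩]
  transitions := (allTrans S N τ).map fun t =>
    (⟨stateCode t.1 % _, Nat.mod_lt _ (by omega)⟩, ⟨letterCode t.2.1 % _, Nat.mod_lt _ (by omega)⟩,
      ⟨stateCode t.2.2 % _, Nat.mod_lt _ (by omega)⟩)

section Language

variable {S N : ℕ} {τ : ℕ → M.A}

/-- The letter of the instance that corresponds to a letter. -/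
noncomputable def toLetter (S N : ℕ) (τ : ℕ → M.A) (l : M.Letter) :
    Fin (errorNFA S N τ).numLetters :=
  ⟨letterCode l % _, Nat.mod_lt _ (Nat.succ_pos _)⟩

/-- The state of the instance that corresponds to a state. -/
noncomputable def toState (S N : ℕ) (τ : ℕ → M.A) (s : M.State) :
    Fin (errorNFA S N τ).numStates :=
  ⟨stateCode s % _, Nat.mod_lt _ (Nat.succ_pos _)⟩

theorem toState_injOn {s s' : M.State} (hs : s.Valid N) (hs' : s'.Valid N)
    (h : toState S N τ s = toState S N τ s') : s = s' := by
  have := congrArg Fin.val h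
  simp only [toState, errorNFA, Nat.mod_eq_of_lt (stateCode_lt hs),
    Nat.mod_eq_of_lt (stateCode_lt hs')] at this
  exact stateCode_injective this

theorem toLetter_injOn {l l' : M.Letter} (hl : l.Valid N) (hl' : l'.Valid N)
    (h : toLetter S N τ l = toLetter S N τ l') : l = l' := by
  have := congrArg Fin.val h
  simp only [toLetter, errorNFA, Nat.mod_eq_of_lt (letterCode_lt hl),
    Nat.mod_eq_of_lt (letterCode_lt hl')] at this
  exact letterCode_injective this

theorem exists_map_toLetter (w : List (Fin (errorNFA S N τ).numLetters)) :
    ∃ v : List M.Letter, (∀ l ∈ v, l.Valid N) ∧ w = v.map (toLetter S N τ) := by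
  induction w with
  | nil => exact ⟨[], by simp, rfl⟩
  | cons a w ih =>
    obtain ⟨v, hv, rfl⟩ := ih
    obtain ⟨l, hl, hla⟩ := exists_letterCode_eq a.2
    refine ⟨l :: v, by simpa using ⟨hl, hv⟩, ?_⟩
    have : a = toLetter S N τ l := Fin.ext (by
      simp only [toLetter, hla]
      exact (Nat.mod_eq_of_lt a.2).symm)
    rw [List.map_cons, ← this]

/-- The transitions of the instance. -/
abbrev NStep (S N : ℕ) (τ : ℕ → M.A) (p : Fin (errorNFA S N τ).numStates)
    (a : Fin (errorNFA S N τ).numLetters) (q : Fin (errorNFA S N τ).numStates) : Prop :=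
  q ∈ (errorNFA S N τ).toNFA.step p a

theorem nstep_iff (p a q) : NStep S N τ p a q ↔ ∃ s l s', Step S N τ s l s' ∧
    p = toState S N τ s ∧ a = toLetter S N τ l ∧ q = toState S N τ s' := by
  have : NStep S N τ p a q ↔ (p, a, q) ∈ (allTrans S N τ).map fun t =>
    (toState S N τ t.1, toLetter S N τ t.2.1, toState S N τ t.2.2) := Iff.rfl
  rw [this]
  simp only [List.mem_map, Prod.exists, mem_allTrans]
  constructor
  · rintro ⟨s, l, s', h, e⟩
    cases e
    exact ⟨s, l, s', h, rfl, rfl, rfl⟩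
  · rintro ⟨s, l, s', h, rfl, rfl, rfl⟩
    exact ⟨s, l, s', h, rfl⟩

theorem run_toNFA {s s' : M.State} {w : List M.Letter} (h : Run (Step S N τ) s w s') :
    Run (NStep S N τ) (toState S N τ s) (w.map (toLetter S N τ)) (toState S N τ s') := by
  induction h with
  | nil s => exact .nil _
  | cons h _ ih => exact .cons ((nstep_iff _ _ _).2 ⟨_, _, _, h, rfl, rfl, rfl⟩) ih

theorem exists_run_of_toNFA (hS : S < N) {w : List M.Letter} (hw : ∀ l ∈ w, l.Valid N) {s : M.State}
    {q : Fin (errorNFA S N τ).numStates}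
    (h : Run (NStep S N τ) (toState S N τ s) (w.map (toLetter S N τ)) q) (hs : s.Valid N) :
    ∃ s', Run (Step S N τ) s w s' := by
  induction w generalizing s with
  | nil => exact ⟨s, .nil s⟩
  | cons l w ih =>
    rcases h with _ | ⟨h1, h2⟩
    obtain ⟨s₁, l₁, s₂, hstep, e1, e2, rfl⟩ := (nstep_iff _ _ _).1 h1
    obtain ⟨v1, v2, v3⟩ := hstep.valid hS
    obtain rfl := toState_injOn hs v1 e1
    obtain rfl := toLetter_injOn (hw l (by simp)) v2 e2
    obtain ⟨s', hs'⟩ := ih (fun l hl => hw l (by simp [hl])) h2 v3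
    exact ⟨s', .cons hstep hs'⟩

theorem mem_accepts_errorNFA {w : List (Fin (errorNFA S N τ).numLetters)} :
    w ∈ (errorNFA S N τ).toNFA.accepts ↔ ∃ s : M.State, (s = error ∨ s = guess) ∧
      Run (NStep S N τ) (toState S N τ error) w (toState S N τ s) := by
  have e0 : toState S N τ error = ⟨0, by simp [errorNFA]⟩ := by simp [toState, stateCode]
  have e1 : toState S N τ guess = ⟨1, by simp [errorNFA]⟩ := by
    simp [toState, stateCode, errorNFA]
  have h : ∀ q, q ∈ (errorNFA S N τ).toNFA.accept ↔ ∃ s : M.State, (s = error ∨ s = guess) ∧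
      q = toState S N τ s := by
    intro q
    rw [show q ∈ (errorNFA S N τ).toNFA.accept ↔ q ∈ ([⟨0, by simp [errorNFA]⟩,
      ⟨1, by simp [errorNFA]⟩] : List (Fin (errorNFA S N τ).numStates)) from Iff.rfl]
    simp only [List.mem_cons, List.not_mem_nil, or_false, exists_eq_or_imp,
      exists_eq_left, e0, e1]
  have hstart : ∀ q, q ∈ (errorNFA S N τ).toNFA.start ↔ q = toState S N τ error := by
    intro q
    rw [show q ∈ (errorNFA S N τ).toNFA.start ↔ q ∈ ([⟨0, by simp [errorNFA]⟩] :
      List (Fin (errorNFA S N τ).numStates)) from Iff.rfl]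
    simp only [List.mem_cons, List.not_mem_nil, or_false, e0]
  rw [NFA.mem_accepts]
  simp only [mem_evalFrom_iff_run, hstart, exists_eq_left, h]
  constructor
  · rintro ⟨_, ⟨s, hs, rfl⟩, hr⟩
    exact ⟨s, hs, hr⟩
  · rintro ⟨s, hs, hr⟩
    exact ⟨_, ⟨s, hs, rfl⟩, hr⟩

/-- The distance from all words to the language of the automaton vanishes if and only if no
rejecting halting configuration is reachable. -/
theorem directedAHned_errorNFA_le_zero_iff {x : List Bool}
    (hS : ∀ c, StateTransition.Reaches M.step (M.init x) c → c.head.natAbs < S) (hN : S + S ≤ N)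
    (hτ : ∀ h, τ h = (M.init x).tape (h - S)) :
    directedAHned Set.univ {w | w ∈ (errorNFA S N τ).toNFA.accepts} ≤ 0 ↔
      ∀ c, StateTransition.Reaches M.step (M.init x) c → M.step c = none → c.state ∈ M.accept := by
  have hSN : S < N := by
    have := hS _ .refl
    omega
  constructor
  · intro h c hc hcn
    by_contra hrej
    obtain ⟨v, hv, hvalid, hrun⟩ := exists_forbidden_factor hS hN hτ hc hcn hrej
    refine absurd h (not_le.2 (directedAHned_univ_pos (v := v.map (toLetter S N τ))
      (by simpa using hv) ?_))
    rintro y hy ⟨y₁, y₂, rfl⟩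
    obtain ⟨s, -, hr⟩ := mem_accepts_errorNFA.1 hy
    obtain ⟨u₁, hu₁, rfl⟩ := exists_map_toLetter y₁
    obtain ⟨u₂, hu₂, rfl⟩ := exists_map_toLetter y₂
    rw [← List.map_append, ← List.map_append] at hr
    obtain ⟨s', hs'⟩ := exists_run_of_toNFA hSN (fun l hl => by
      simp only [List.mem_append] at hl
      rcases hl with (hl | hl) | hl
      exacts [hu₁ l hl, hvalid l hl, hu₂ l hl]) hr trivial
    obtain ⟨_, hs', -⟩ := hs'.of_append
    obtain ⟨_, -, hs'⟩ := hs'.of_append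
    exact hrun _ _ hs'
  · intro hx
    have : {w | w ∈ (errorNFA S N τ).toNFA.accepts} = Set.univ := by
      refine Set.eq_univ_of_forall fun w => ?_
      obtain ⟨u, hu, rfl⟩ := exists_map_toLetter w
      obtain ⟨s, hs, hr⟩ := exists_run_of_accepts hS hN hτ hx _ u hu le_rfl
      exact mem_accepts_errorNFA.2 ⟨s, hs, run_toNFA hr⟩
    rw [this, directedAHned_univ_univ]

end Language

/-! ### Printing the instance -/

/-- The part of the encoding of a list of transitions that is due to one transition. -/
noncomputable def encodeTr (t : M.Tr) : List Bool :=
  true :: (encodeUnary (stateCode t.1) ++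
    (encodeUnary (letterCode t.2.1) ++ encodeUnary (stateCode t.2.2)))

theorem encodeListWith_eq_flatMap {β : Type*} (e : β → List Bool) (l : List β) :
    encodeListWith e l = l.flatMap (fun b => true :: e b) ++ [false] := by
  induction l with
  | nil => rfl
  | cons b l ih => simp [encodeListWith, ih]

/-- The part of the encoding of the instance in front of the transitions: the numbers of letters and
of states, the initial states and the accepting states. -/
noncomputable def encodeHeader (M : TapeMachine) (N : ℕ) : List Bool :=
  encodeUnary (letterWidth M * N + 1) ++ encodeUnary (stateWidth M * (N + 2) + 2) ++
    (encodeListWith encodeUnary [0] ++ encodeListWith encodeUnary [0, 1])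

theorem encodeInstance_errorNFA {S N : ℕ} {τ : ℕ → M.A} (hS : S < N) :
    encodeInstance (errorNFA S N τ, 0) = encodeHeader M N ++
      (catBelow (fun i => (rowTrans (τ i) i).flatMap encodeTr) N ++
        (([(error, sharp, guess)] ++ [(error, sharp, expect (S + 1) M.start)]).flatMap encodeTr ++
          false :: encodeRat 0)) := by
  have h : encodeListWith (fun t : Fin (errorNFA S N τ).numStates × _ × _ =>
      encodeFin t.1 ++ (encodeFin t.2.1 ++ encodeFin t.2.2)) (errorNFA S N τ).transitions =
      (allTrans S N τ).flatMap encodeTr ++ [false] := by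
    rw [encodeListWith_eq_flatMap]
    simp only [errorNFA, List.flatMap_map]
    congr 1
    refine List.flatMap_congr fun t ht => ?_
    obtain ⟨s, l, s'⟩ := t
    obtain ⟨h1, h2, h3⟩ := (mem_allTrans.1 ht).valid hS
    simp only [encodeFin, encodeTr, Nat.mod_eq_of_lt (stateCode_lt h1),
      Nat.mod_eq_of_lt (letterCode_lt h2), Nat.mod_eq_of_lt (stateCode_lt h3)]
  simp only [encodeInstance, FiniteNFA.encode, h, allTrans, List.flatMap_append, flatMap_catBelow,
    List.append_assoc, encodeHeader]
  rfl

/-- Linear forms in two variables. -/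
def Linear (φ : ℕ → ℕ → ℕ) : Prop := ∃ a b c, ∀ i j, φ i j = a * i + b * j + c

theorem linear_const (n : ℕ) : Linear fun _ _ => n := ⟨0, 0, n, by simp⟩

theorem linear_fst : Linear fun i _ => i := ⟨1, 0, 0, by simp⟩

theorem linear_snd : Linear fun _ j => j := ⟨0, 1, 0, by simp⟩

theorem Linear.mul_add {φ : ℕ → ℕ → ℕ} (h : Linear φ) (m n : ℕ) :
    Linear fun i j => m * φ i j + n := by
  obtain ⟨a, b, c, h⟩ := h
  exact ⟨m * a, m * b, m * c + n, fun i j => by simp only [h]; ring⟩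

theorem Linear.add {φ : ℕ → ℕ → ℕ} (h : Linear φ) (n : ℕ) : Linear fun i j => φ i j + n := by
  simpa using h.mul_add 1 n

/-- Lists of transitions whose encoding can be printed. -/
def TrEmits (g : ℕ → ℕ → List M.Tr) : Prop := Emits fun i j => (g i j).flatMap encodeTr

theorem TrEmits.append {g g' : ℕ → ℕ → List M.Tr} (h : TrEmits g) (h' : TrEmits g') :
    TrEmits fun i j => g i j ++ g' i j := by
  simpa only [TrEmits, List.flatMap_append] using Emits.append h h'

theorem trEmits_nil : TrEmits fun _ _ => ([] : List M.Tr) := emits_const []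

theorem trEmits_flatMap {β : Type*} (l : List β) {g : β → ℕ → ℕ → List M.Tr}
    (h : ∀ b, TrEmits (g b)) : TrEmits fun i j => l.flatMap fun b => g b i j := by
  induction l with
  | nil => exact trEmits_nil
  | cons b l ih => exact (h b).append ih

theorem trEmits_singleton {s s' : ℕ → ℕ → M.State} {l : ℕ → ℕ → M.Letter}
    (hs : Linear fun i j => stateCode (s i j)) (hl : Linear fun i j => letterCode (l i j))
    (hs' : Linear fun i j => stateCode (s' i j)) :
    TrEmits fun i j => [(s i j, l i j, s' i j)] := by
  obtain ⟨a₁, b₁, c₁, h₁⟩ := hs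
  obtain ⟨a₂, b₂, c₂, h₂⟩ := hl
  obtain ⟨a₃, b₃, c₃, h₃⟩ := hs'
  have := (emits_const [true]).append
    ((emits_unary a₁ b₁ c₁ h₁).append ((emits_unary a₂ b₂ c₂ h₂).append (emits_unary a₃ b₃ c₃ h₃)))
  simpa [TrEmits, encodeTr] using this

theorem linear_error : Linear fun _ _ => stateCode (error : M.State) := linear_const _

theorem linear_guess : Linear fun _ _ => stateCode (guess : M.State) := linear_const _

theorem linear_expect {φ : ℕ → ℕ → ℕ} (h : Linear φ) (q : M.Q) :
    Linear fun i j => stateCode (expect (φ i j) q) := h.mul_add _ _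

theorem linear_cell {φ : ℕ → ℕ → ℕ} (h : Linear φ) (b : M.A) :
    Linear fun i j => stateCode (cell (φ i j) b) := h.mul_add _ _

theorem linear_sharp : Linear fun _ _ => letterCode (sharp : M.Letter) := linear_const _

theorem linear_ev {φ : ℕ → ℕ → ℕ} (h : Linear φ) (q : M.Q) (a : M.A) :
    Linear fun i j => letterCode (ev (φ i j) q a) := h.mul_add _ _

theorem linear_target (dir : Turing.Dir) : Linear fun i _ => target i dir := by
  cases dir
  exacts [linear_fst, linear_fst.add 2]

open Classical in
theorem trEmits_cellTrans : TrEmits fun i _ => cellTrans (M := M) i := by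
  have hmove : ∀ (q : M.Q) (a : M.A), TrEmits fun i _ => match M.δ q a with
      | some (q', b, dir) =>
        [(guess, ev i q a, expect (target i dir) q')] ++ [(guess, ev i q a, cell (i + 1) b)]
      | none => if q ∈ M.accept then [(guess, ev i q a, error)] else [] := by
    intro q a
    rcases M.δ q a with _ | ⟨q', b, dir⟩
    · by_cases h : q ∈ M.accept
      · simpa only [h, if_true] using
          trEmits_singleton linear_guess (linear_ev linear_fst q a) linear_error
      · simpa only [h, if_false] using trEmits_nil
    · exact (trEmits_singleton linear_guess (linear_ev linear_fst q a)
        (linear_expect (linear_target dir) q')).append (trEmits_singleton linear_guess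
        (linear_ev linear_fst q a) (linear_cell (linear_fst.add 1) b))
  have hstate : ∀ (q q' : M.Q) (a : M.A), TrEmits fun i _ =>
      if q ≠ q' then [(expect (i + 1) q, ev i q' a, error)] else [] := by
    intro q q' a
    by_cases h : q = q'
    · simpa [h] using trEmits_nil
    · simpa [h] using trEmits_singleton
        (linear_expect (linear_fst.add 1) q) (linear_ev linear_fst q' a) linear_error
  have hread : ∀ (b : M.A) (q : M.Q) (a : M.A), TrEmits fun i _ =>
      if b ≠ a then [(cell (i + 1) b, ev i q a, error)] else [] := by
    intro b q a
    by_cases h : b = a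
    · simpa [h] using trEmits_nil
    · simpa [h] using trEmits_singleton
        (linear_cell (linear_fst.add 1) b) (linear_ev linear_fst q a) linear_error
  exact (((trEmits_flatMap _ fun ⟨q, a⟩ => ((trEmits_singleton linear_error
    (linear_ev linear_fst q a) linear_error).append (trEmits_singleton linear_guess
    (linear_ev linear_fst q a) linear_guess)).append (hmove q a)).append
    (trEmits_flatMap _ fun q =>
      trEmits_singleton (linear_expect (linear_fst.add 1) q) linear_sharp linear_error)).append
    (trEmits_flatMap _ fun ⟨q, q', a⟩ => hstate q q' a)).append
    (trEmits_flatMap _ fun ⟨b, q, a⟩ => hread b q a)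

theorem trEmits_pairTrans {φ ψ : ℕ → ℕ → ℕ} (hφ : Linear φ) (hψ : Linear ψ) :
    TrEmits fun i j => pairTrans (M := M) (φ i j) (ψ i j) :=
  (trEmits_flatMap _ fun ⟨q, q', a⟩ => trEmits_singleton (linear_expect (hφ.add 1) q)
    (linear_ev hψ q' a) linear_error).append (trEmits_flatMap _ fun ⟨b, q, a⟩ =>
    trEmits_singleton (linear_cell (hφ.add 1) b) (linear_ev hψ q a) (linear_cell (hφ.add 1) b))

theorem emitsAt_rowTrans (b : M.A) : EmitsAt fun i => (rowTrans b i).flatMap encodeTr := by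
  have h1 := Emits.emitsAt ((trEmits_singleton linear_error linear_sharp
    (linear_cell (linear_fst.add 1) b)).append trEmits_cellTrans)
  have h2 := Emits.emitsAt_catBelow ((trEmits_pairTrans (M := M) linear_fst linear_snd).append
    (trEmits_pairTrans linear_snd linear_fst))
  simpa only [rowTrans, List.flatMap_append (xs := _ ++ _), flatMap_catBelow] using h1.append h2

theorem emitsAt_encodeHeader : EmitsAt (encodeHeader M) := by
  obtain ⟨a, b, c, h⟩ := linear_fst.mul_add (letterWidth M) 1
  obtain ⟨a', b', c', h'⟩ := (linear_fst.add 2).mul_add (stateWidth M) 2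
  exact Emits.emitsAt (((emits_unary a b c h).append (emits_unary a' b' c' h')).append
    (emits_const _))

/-- The instance to which the input `x` of a machine is reduced: there are `S + |x| + S` cells, the
input starting at the cell number `S`, where `S` is larger than the space used. -/
noncomputable def reduction (M : TapeMachine) (p : Polynomial ℕ) (x : List Bool) : FiniteNFA :=
  errorNFA ((p + 1).eval x.length) ((p + 1).eval x.length + x.length + (p + 1).eval x.length)
    fun h => (M.init x).tape (h - ((p + 1).eval x.length : ℕ))

theorem computableInPolyTime_reduction (M : TapeMachine) (p : Polynomial ℕ) :
    Nonempty (Turing.TM2ComputableInPolyTime id id fun x =>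
      encodeInstance (reduction M p x, 0)) := by
  have hS : EmitsAt fun S => (([(error, sharp, guess)] ++
      [(error, sharp, expect (S + 1) M.start)]).flatMap encodeTr ++ false :: encodeRat 0) :=
    Emits.emitsAt (Emits.append ((trEmits_singleton linear_error linear_sharp linear_guess).append
      (trEmits_singleton linear_error linear_sharp (linear_expect (linear_fst.add 1) M.start)))
      (emits_const (false :: encodeRat 0)))
  have := computableInPolyTime_of_emitsAt (p + 1) (emitsAt_encodeHeader (M := M)) hS
    (emitsAt_rowTrans M.blank) (fun b => emitsAt_rowTrans (M.inputSym b))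
    (fun x i => (rowTrans ((M.init x).tape (i - ((p + 1).eval x.length : ℕ))) i).flatMap encodeTr)
    ?_ ?_ ?_
  · have e : (fun x => encodeInstance (reduction M p x, 0)) = _ := funext fun x =>
      encodeInstance_errorNFA (by simp only [Polynomial.eval_add, Polynomial.eval_one]; omega)
    rw [e]
    exact this
  · intro x k hk
    obtain ⟨m, hm⟩ : ∃ m, (k : ℤ) - ((p + 1).eval x.length : ℕ) = Int.negSucc m :=
      Int.eq_negSucc_of_lt_zero (by omega)
    simp only [hm, init]
  · intro x k b hk
    have : (((p + 1).eval x.length + k : ℕ) : ℤ) - ((p + 1).eval x.length : ℕ) = .ofNat k := by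
      simp
    simp only [this, init, hk, Option.elim]
  · intro x k hk
    have : (((p + 1).eval x.length + x.length + k : ℕ) : ℤ) - ((p + 1).eval x.length : ℕ) =
        .ofNat (x.length + k) := by
      push_cast
      simp only [Int.ofNat_eq_natCast]
      push_cast
      ring
    simp only [this, init, List.getElem?_eq_none (Nat.le_add_right _ _), Option.elim]

/-- The machine being deterministic, the halting configuration is unique, so that acceptance can be
expressed by a universal quantifier. -/
theorem mem_iff_of_decidesInSpace {L : Language Bool} {s : ℕ → ℕ} (h : M.DecidesInSpace L s)
    (x : List Bool) : x ∈ L ↔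
      ∀ c, StateTransition.Reaches M.step (M.init x) c → M.step c = none → c.state ∈ M.accept := by
  obtain ⟨-, c, hc, hcn, hcx⟩ := h x
  have halted : ∀ {c c' : M.Cfg}, M.step c = none → StateTransition.Reaches M.step c c' →
      c = c' := by
    intro c c' h h'
    rcases Relation.ReflTransGen.cases_head h' with h' | ⟨c₁, h', -⟩
    · exact h'
    · rw [h] at h'
      cases h'
  rw [← hcx]
  refine ⟨fun hacc c' hc' hcn' => ?_, fun H => H c hc hcn⟩
  rcases StateTransition.reaches_total hc hc' with h | h
  · exact halted hcn h ▸ hacc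
  · exact (halted hcn' h).symm ▸ hacc

end TapeMachine

theorem encodeInstance_mem_iff (T : FiniteNFA) : encodeInstance (T, 0) ∈ directedAHnedProblem ↔
    directedAHned Set.univ {w | w ∈ T.toNFA.accepts} ≤ 0 := by
  have e : ∀ a : ℝ≥0∞, (a : EReal) ≤ (((0 : ℚ) : ℝ) : EReal) ↔ a ≤ 0 := by
    intro a
    rw [Rat.cast_zero, EReal.coe_zero, ← EReal.coe_ennreal_zero,
      EReal.coe_ennreal_le_coe_ennreal_iff]
  constructor
  · rintro ⟨T', ν, h, h'⟩
    obtain ⟨rfl, rfl⟩ := Prod.mk.inj (encodeInstance_injective h)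
    exact (e _).1 h'
  · exact fun h => ⟨T, 0, rfl, (e _).2 h⟩

end AsympHausdorff

theorem mainTheorem8 : AsympHausdorff.PSPACEHard AsympHausdorff.directedAHnedProblem := by
  rintro L ⟨M, p, hM⟩
  refine ⟨_, M.computableInPolyTime_reduction p, fun x => ?_⟩
  rw [AsympHausdorff.encodeInstance_mem_iff, AsympHausdorff.TapeMachine.mem_iff_of_decidesInSpace hM]
  refine (AsympHausdorff.TapeMachine.directedAHned_errorNFA_le_zero_iff (fun c hc => ?_) ?_
    fun h => rfl).symm
  · have := (hM x).1 c hc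
    simp only [Polynomial.eval_add, Polynomial.eval_one]
    exact Nat.lt_succ_of_le this
  · omega
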